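/- For a real number $a$ and real letters $k_1,\dots,k_n$ let $$\mathrm{Hlog}(a,[k_1,\dots,k_n])=\int_0^a\frac{dx_1}{x_1-k_1}\int_0^{x_1}\frac{dx_2}{x_2-k_2}\cdots\int_0^{x_{n-1}}\frac{dx_n}{x_n-k_n},\qquad \mathrm{Hlog}(a,[\,])=1,$$ with the convention $\mathrm{Hlog}(a,[0,\dots,0])=\log(a)^n/n!$ for $n$ zeros. Let ${}_2F_1(a,b;c;z)$, $z<1$, denote the analytic continuation to $(-\infty,1)$ of Gauss' hypergeometric series. Let $\lambda\in\mathbb R$ with $|\lambda|\le\frac1\pi$, put $\alpha=\frac{\arcsin(\lambda\pi)}{\pi}$ and $c_\lambda=\frac{\lambda}{\alpha(1-\alpha)}$, where $\frac{\alpha}{\lambda}=\frac{\arcsin(\lambda\pi)}{\lambda\pi}$ and $c_\lambda$ are read as $1$ at $\lambda=0$, and define $$f(x)=\sum_{n=0}^\infty \mathrm{Hlog}(x,[\underbrace{0,-1,\dots,0,-1}_{n\text{ pairs}}])\,\alpha^{2n},\qquad g(x)=\sum_{n=0}^\infty \mathrm{Hlog}(x,[-1,\underbrace{0,-1,\dots,0,-1}_{n\text{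 pairs}}])\,\alpha^{2n}.$$ 1. For every $x>-1$ both series converge absolutely, and $$f(x)={}_2F_1(\alpha,-\alpha;1;-x),\qquad g(x)=x\;{}_2F_1(1+\alpha,1-\alpha;2;-x).$$ 2. Let in addition $\lambda>-\frac1\pi$. A real constant $c$ and a function $\phi$ on $[0,\infty)$, $\phi\in L^2(\mathbb R_+)$, satisfy $$\phi(x)=\frac{c}{1+x}-\lambda\int_0^\infty\frac{\phi(t)\,dt}{1+t+x}\quad(x\ge 0),\qquad \phi(0)=1,$$ if and only if $c=c_\lambda$, $\phi(0)=1$ and, for all $x>0$, $$\phi(x)=\frac{c_\lambda}{1+x}\,\frac{\arcsin(\lambda\pi)}{\lambda\pi}\,f(x)-\frac{\lambda c_\lambda}{x}\Big(\frac{\arcsin(\lambda\pi)}{\lambda\pi}\Big)^2 g(x).$$ Moreover, for $x>0$ the right hand side equals ${}_2F_1(1+\alpha,2-\alpha;2;-x)$. 3. Let $-\frac1\pi<\lambda\le\frac1\pi$ and $\mu>0$. A function $J$ on $[0,\infty)$ with $\frac{J(x)}{x(\mu^2+x)}\in L^2(\mathbb R_+)$ satisfies $$J(x)=x-\lambda x^2\int_0^\infty\frac{J(t)\,dt}{(t+\mu^2)^2(t+\mu^2+x)}\qquad(x\ge0)$$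 if and only if $J(x)=x\;{}_2F_1\big(\alpha,1-\alpha;2;-\tfrac{x}{\mu^2}\big)$ for all $x\ge 0$. For $x>0$ this function equals $x\big(1+\frac{x}{\mu^2}\big)\phi\big(\frac{x}{\mu^2}\big)$, with $\phi$ the combination of $f$ and $g$ in part 2. 4. Let $|\lambda|<\frac1\pi$, $\mu>0$, $x>0$, $u=x/\mu^2$. Let $b_{k,n}$ be the coefficient of $\lambda^k$ in the Taylor series of $\frac{\alpha^n}{1-\alpha}$ at $\lambda=0$, and put $$H_{2m}(u)=\mathrm{Hlog}(u,[\underbrace{0,-1,\dots,0,-1}_{m\text{ pairs}}]),\qquad H_{2m+1}(u)=-\frac{1+u}{u}\,\mathrm{Hlog}(u,[-1,\underbrace{0,-1,\dots,0,-1}_{m\text{ pairs}}]).$$ Then the solution $J$ of part 3 is the sum of the convergent power series $$J(x)=\sum_{k=0}^\infty\lambda^k\; x\sum_{n=0}^k b_{k,n}\,H_n(u).$$ -/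

import Mathlib

open Set MeasureTheory

/-- Hyperlogarithm `Hlog a [k₁, …, kₙ] = ∫₀^a dx₁/(x₁-k₁) ∫₀^{x₁} dx₂/(x₂-k₂) ⋯ ∫₀^{x_{n-1}} dxₙ/(xₙ-kₙ)`
with real letters, with `Hlog a [] = 1` and the usual regularisation
`Hlog a [0, …, 0] = log(a)^n / n!` of the divergent words consisting of zeros only. -/
noncomputable def Hlog : ℝ → List ℝ → ℝ
  | _, [] => 1
  | a, k :: ks =>
    if ∀ j ∈ k :: ks, j = 0 then
      Real.log a ^ (k :: ks).length / ((k :: ks).length.factorial : ℝ)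
    else ∫ x in (0 : ℝ)..a, Hlog x ks / (x - k)

/-- The word `[0, -1, …, 0, -1]`, with `n` times the pair `0, -1`. -/
def altWord (n : ℕ) : List ℝ := (List.replicate n [(0 : ℝ), -1]).flatten

/-- `F` is the analytic continuation to `(-∞, 1)` of Gauss' hypergeometric power series. -/
def IsGaussContinuation (a b c : ℝ) (F : ℝ → ℝ) : Prop :=
  AnalyticOnNhd ℝ F (Iio 1) ∧ ∀ z : ℝ, |z| < 1 → F z = ordinaryHypergeometric a b c z

open Classical in
/-- Gauss' hypergeometric function `₂F₁(a, b; c; z)` for real `z < 1`: the value at `z` of the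
analytic continuation to `(-∞, 1)` of the hypergeometric series, unique by the next lemma.
(Mathlib's `ordinaryHypergeometric` is only the sum of the series and is zero by convention where
the series diverges.) -/
noncomputable def gauss2F1 (a b c z : ℝ) : ℝ :=
  if h : ∃ F : ℝ → ℝ, IsGaussContinuation a b c F then h.choose z
  else ordinaryHypergeometric a b c z

theorem gauss2F1_eq {a b c : ℝ} {F : ℝ → ℝ} (hF : IsGaussContinuation a b c F) {z : ℝ}
    (hz : z < 1) : gauss2F1 a b c z = F z := by
  have h : ∃ F : ℝ → ℝ, IsGaussContinuation a b c F := ⟨F, hF⟩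
  have hc := h.choose_spec
  have key : EqOn h.choose F (Iio 1) := by
    refine hc.1.eqOn_of_preconnected_of_eventuallyEq hF.1 isPreconnected_Iio
      (z₀ := 0) (by simp) ?_
    have : Ioo (-1 : ℝ) 1 ∈ nhds (0 : ℝ) := Ioo_mem_nhds (by norm_num) (by norm_num)
    filter_upwards [this] with y hy
    have hy' : |y| < 1 := abs_lt.mpr hy
    rw [hc.2 y hy', hF.2 y hy']
  have hd : gauss2F1 a b c z = h.choose z := by
    unfold gauss2F1
    rw [dif_pos h]
  rw [hd]
  exact key hz

/-- `α = arcsin(λπ)/π`. -/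
noncomputable def alphaOf (l : ℝ) : ℝ := Real.arcsin (l * Real.pi) / Real.pi

/-- `f(x) = ∑ₙ Hlog(x, [0, -1, …, 0, -1]) α^{2n}` (`n` pairs of letters). -/
noncomputable def fHlog (l x : ℝ) : ℝ := ∑' n : ℕ, Hlog x (altWord n) * alphaOf l ^ (2 * n)

/-- `g(x) = ∑ₙ Hlog(x, [-1, 0, -1, …, 0, -1]) α^{2n}` (`n` pairs after the first letter). -/
noncomputable def gHlog (l x : ℝ) : ℝ :=
  ∑' n : ℕ, Hlog x (-1 :: altWord n) * alphaOf l ^ (2 * n)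

/-- `arcsin(λπ)/(λπ) = α/λ`, with its limit `1` at `λ = 0`. -/
noncomputable def arcsinQuot (l : ℝ) : ℝ :=
  if l = 0 then 1 else Real.arcsin (l * Real.pi) / (l * Real.pi)

/-- `c_λ = λ/(α(1-α))`, with its limit `1` at `λ = 0`. -/
noncomputable def cOf (l : ℝ) : ℝ := if l = 0 then 1 else l / (alphaOf l * (1 - alphaOf l))

/-- `c_λ arcsin(λπ)/(λπ) f(x)/(1+x) - λ c_λ (arcsin(λπ)/(λπ))² g(x)/x`, for `x > 0`. -/
noncomputable def phiHlog (l x : ℝ) : ℝ :=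
  cOf l * arcsinQuot l / (1 + x) * fHlog l x - l * cOf l * arcsinQuot l ^ 2 / x * gHlog l x

/-- `φ ∈ L²(ℝ₊)` solves the rescaled, symmetrised Fredholm equation with constant `c`:
`φ(x) = c/(1+x) - λ ∫₀^∞ φ(t)/(1+t+x) dt` for all `x ≥ 0`, normalised by `φ(0) = 1`. -/
def IsPhiSolution (l c : ℝ) (φ : ℝ → ℝ) : Prop :=
  MemLp φ 2 (volume.restrict (Ioi 0)) ∧ φ 0 = 1 ∧
    ∀ x : ℝ, 0 ≤ x → φ x = c / (1 + x) - l * ∫ t in Ioi (0 : ℝ), φ t / (1 + t + x)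

/-- `J` solves the Fredholm equation
`J(x) = x - λ x² ∫₀^∞ J(t)/((t+μ²)²(t+μ²+x)) dt` for all `x ≥ 0`,
in the class of functions for which `J(x)/(x(μ²+x))` belongs to `L²(ℝ₊)`. -/
def IsFredholmSolution (l μ : ℝ) (J : ℝ → ℝ) : Prop :=
  MemLp (fun x => J x / (x * (μ ^ 2 + x))) 2 (volume.restrict (Ioi 0)) ∧
    ∀ x : ℝ, 0 ≤ x →
      J x = x - l * x ^ 2 * ∫ t in Ioi (0 : ℝ), J t / ((t + μ ^ 2) ^ 2 * (t + μ ^ 2 + x))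

/-- The coefficient of `λ^k` in the Taylor series at `λ = 0` of `α^n/(1-α)`, `α = arcsin(λπ)/π`. -/
noncomputable def alphaTaylor (k n : ℕ) : ℝ :=
  iteratedDeriv k (fun l : ℝ => alphaOf l ^ n / (1 - alphaOf l)) 0 / (k.factorial : ℝ)

/-- The hyperlogarithm that goes with `α^n` in the expansion of `J`: for even `n = 2m` it is
`Hlog(u, [0,-1,…,0,-1])`, and for odd `n = 2m+1` it is `-((1+u)/u) Hlog(u, [-1,0,-1,…,0,-1])`,
with `n` letters in both cases (for `u > 0`). -/
noncomputable def letterTerm (u : ℝ) (n : ℕ) : ℝ :=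
  if Even n then Hlog u (altWord (n / 2))
  else -((1 + u) / u) * Hlog u (-1 :: altWord (n / 2))

/-- The coefficient of `λ^k` in the expansion of `J(x)`, a combination of hyperlogarithms of
`x/μ²` with at most `k` letters. -/
noncomputable def JCoeff (μ x : ℝ) (k : ℕ) : ℝ :=
  x * ∑ n ∈ Finset.range (k + 1), alphaTaylor k n * letterTerm (x / μ ^ 2) n

/-!
Write `F = ₂F₁(α, -α; 1; -x)`, `G = ₂F₁(1 + α, 1 - α; 2; -x)`, `Φ = ₂F₁(1 + α, 2 - α; 2; -x)`.
Euler's integral, read as an expectation under a beta measure, continues these series to `x > -1`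
and controls their decay at infinity; contiguity gives `F' = α² G`, `(x G)' = F / (1 + x)` and
`(1 - α) Φ = F / (1 + x) - α G`. Iterating the first-order system for `(F, x G)` from `0` produces
exactly the words `[0, -1, …, 0, -1]` and `[-1, 0, -1, …, 0, -1]`, with remainders
`O(r ^ N / N!)`.

For the equation of `φ`, put `W = F - α x G`, so that `(x (1 + x) Φ)' = W` and
`W' = -α (1 - α) Φ`. Integrating by parts, the moments `∫ Φ(t) (1 + t)^(-n-1) dt` satisfy the same
first-order recurrence in `n` as the Taylor coefficients of `Φ`, up to the constant `W(0) = 1`. The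
moments tend to `0` and the coefficients to `c = 1 / (Γ(1 + α) Γ(2 - α)) ≠ 0`, so the sequence
`coefficient + α (1 - α) c · moment - c` solves the homogeneous recurrence and tends to `0`: being a
multiple of the coefficients, it vanishes. This is the equation near `x = 0`, and analyticity
extends it. The reflection formula turns `α (1 - α) c` into `sin (π α) / π = λ`. Uniqueness is the
Schur test with weight `√x`: the weighted row integrals `π √(x / (1 + x))` stay strictly below `π`,
so the homogeneous equation has no nonzero `L²` solution even for `|λ| = 1 / π`.

The substitution `J (μ² u) = μ² u (1 + u) φ(u)` and a partial fraction decomposition turn the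
Fredholm equation for `J` into that of `φ`, the constant `c` being fixed by `φ(0) = 1`. Finally
`arcsin` has nonnegative Taylor coefficients, hence so does `α ^ n / (1 - α)`, and the absolute
convergence of the `α`-expansion at `|λ|` permits rearranging it into a power series in `λ`.
-/

open Filter Topology

/-- The power series `p` converges to `F` on the ball `‖x‖ < r`; unlike `HasFPowerSeriesOnBall` this
is multiplicative, its coefficients living in the ring `PowerSeries 𝕜`. -/
def HasPowerSum {𝕜 : Type*} [RCLike 𝕜] (p : PowerSeries 𝕜) (F : 𝕜 → 𝕜) (r : ℝ) : Prop :=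
  ∀ x : 𝕜, ‖x‖ < r → HasSum (fun n => p.coeff n * x ^ n) (F x)

namespace HasPowerSum

variable {𝕜 : Type*} [RCLike 𝕜] {p q : PowerSeries 𝕜} {F G : 𝕜 → 𝕜} {r s : ℝ}

theorem congr (h : HasPowerSum p F r) (hFG : ∀ x, ‖x‖ < r → F x = G x) : HasPowerSum p G r :=
  fun x hx => hFG x hx ▸ h x hx

theorem add (hF : HasPowerSum p F r) (hG : HasPowerSum q G r) :
    HasPowerSum (p + q) (fun x => F x + G x) r := fun x hx => by
  simpa [add_mul] using (hF x hx).add (hG x hx)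

theorem const (c : 𝕜) (r : ℝ) : HasPowerSum (PowerSeries.C c) (fun _ => c) r := fun x _ => by
  have h := hasSum_ite_eq (L := .unconditional ℕ) 0 c
  refine h.congr_fun fun n => ?_
  by_cases hn : n = 0 <;> simp [PowerSeries.coeff_C, hn]

theorem X (r : ℝ) : HasPowerSum PowerSeries.X (fun x : 𝕜 => x) r := fun x _ => by
  refine (hasSum_ite_eq (L := .unconditional ℕ) 1 x).congr_fun fun n => ?_
  by_cases hn : n = 1 <;> simp [PowerSeries.coeff_X, hn]

theorem sub (hF : HasPowerSum p F r) (hG : HasPowerSum q G r) :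
    HasPowerSum (p - q) (fun x => F x - G x) r := fun x hx => by
  simpa [sub_mul] using (hF x hx).sub (hG x hx)

theorem one_sub (r : ℝ) : HasPowerSum (1 - PowerSeries.X) (fun x : 𝕜 => 1 - x) r := by
  simpa using (const (1 : 𝕜) r).sub (X r)

theorem mul (hF : HasPowerSum p F r) (hG : HasPowerSum q G r) :
    HasPowerSum (p * q) (fun x => F x * G x) r := fun x hx => by
  have hp := (hF x hx).summable.norm
  have hq := (hG x hx).summable.norm
  have hpq := (summable_norm_sum_mul_antidiagonal_of_summable_norm hp hq).of_norm.hasSum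
  rw [← tsum_mul_tsum_eq_tsum_sum_antidiagonal_of_summable_norm hp hq, (hF x hx).tsum_eq,
    (hG x hx).tsum_eq] at hpq
  refine hpq.congr_fun fun n => ?_
  rw [PowerSeries.coeff_mul, Finset.sum_mul]
  refine Finset.sum_congr rfl fun kl hkl => ?_
  rw [← Finset.HasAntidiagonal.mem_antidiagonal.mp hkl, pow_add]
  ring

theorem pow (hF : HasPowerSum p F r) (n : ℕ) : HasPowerSum (p ^ n) (fun x => F x ^ n) r := by
  induction n with
  | zero => simpa using const (1 : 𝕜) r
  | succ n ih => simpa [pow_succ] using ih.mul hF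

theorem const_mul (c : 𝕜) (hF : HasPowerSum p F r) :
    HasPowerSum (PowerSeries.C c * p) (fun x => c * F x) r := (const c r).mul hF

theorem hasFPowerSeriesOnBall {z : 𝕜} (h : HasPowerSum p (fun x => F (z + x)) r) (hr : 0 < r) :
    HasFPowerSeriesOnBall F (FormalMultilinearSeries.ofScalars 𝕜 fun n => p.coeff n) z
      (ENNReal.ofReal r) where
  r_le := by
    refine ENNReal.le_of_forall_nnreal_lt fun s hs => ?_
    refine FormalMultilinearSeries.le_radius_of_summable_norm _ ?_
    have hs' : ‖((s : ℝ) : 𝕜)‖ < r := by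
      rw [ENNReal.ofReal, ENNReal.coe_lt_coe, Real.lt_toNNReal_iff_coe_lt] at hs
      simpa using hs
    simpa [FormalMultilinearSeries.ofScalars_norm] using (h _ hs').summable.norm
  r_pos := ENNReal.ofReal_pos.mpr hr
  hasSum := fun {y} hy => by
    have hy' : ‖y‖ < r := by simpa [edist_eq_enorm_sub, ← ofReal_norm, hr] using hy
    simpa [FormalMultilinearSeries.ofScalars_apply_eq, mul_comm] using h y hy'

theorem analyticAt {z : 𝕜} (h : HasPowerSum p (fun x => F (z + x)) r) (hr : 0 < r) :
    AnalyticAt 𝕜 F z := (h.hasFPowerSeriesOnBall hr).analyticAt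

theorem coeff_eq (h : HasPowerSum p F r) (hr : 0 < r) (n : ℕ) :
    p.coeff n = iteratedDeriv n F 0 / (n.factorial : 𝕜) := by
  have hF := HasPowerSum.hasFPowerSeriesOnBall (z := (0 : 𝕜)) (F := F) (by simpa using h) hr
  have heq := hF.hasFPowerSeriesAt.eq_formalMultilinearSeries hF.analyticAt.hasFPowerSeriesAt
  simpa [FormalMultilinearSeries.coeff_ofScalars] using congrArg (fun s => s.coeff n) heq

theorem eventuallyEq (hF : HasPowerSum p F r) (hG : HasPowerSum p G s) (hr : 0 < r) (hs : 0 < s) :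
    F =ᶠ[𝓝 0] G := by
  filter_upwards [Metric.ball_mem_nhds (0 : 𝕜) hr, Metric.ball_mem_nhds (0 : 𝕜) hs] with x hxr hxs
  exact (hF x (by simpa using hxr)).unique (hG x (by simpa using hxs))

theorem deriv (h : HasPowerSum p F r) (hr : 0 < r) :
    HasPowerSum (PowerSeries.derivative 𝕜 p) (deriv F) r := fun x hx => by
  have hF := HasPowerSum.hasFPowerSeriesOnBall (z := (0 : 𝕜)) (F := F) (by simpa using h) hr
  have hx' : x ∈ Metric.eball 0 (ENNReal.ofReal r) := by
    simpa [edist_eq_enorm_sub, ← ofReal_norm, hr] using hx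
  have hsum := (ContinuousLinearMap.apply 𝕜 𝕜 (1 : 𝕜)).hasSum (hF.fderiv.hasSum hx')
  simp only [zero_add] at hsum
  refine hsum.congr_fun fun n => ?_
  rw [ContinuousLinearMap.apply_apply, FormalMultilinearSeries.apply_eq_pow_smul_coeff, smul_apply,
    FormalMultilinearSeries.derivSeries_coeff_one,
    FormalMultilinearSeries.coeff_ofScalars, PowerSeries.coeff_derivative]
  simp [mul_comm]

end HasPowerSum

section IntegralOfPowerSeries

variable {X : Type*} [MeasurableSpace X] {ν : Measure X}

theorem integrable_mul_pow_of_norm_le {𝕜 : Type*} [RCLike 𝕜] {w u : X → 𝕜} {R : ℝ}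
    (hw : Integrable w ν) (hu : AEStronglyMeasurable u ν) (hR : ∀ᵐ s ∂ν, ‖u s‖ ≤ R) (n : ℕ) :
    Integrable (fun s => w s * u s ^ n) ν := by
  refine hw.mul_bdd (c := R ^ n) (hu.pow n) ?_
  filter_upwards [hR] with s hs
  rw [norm_pow]
  gcongr

theorem HasPowerSum.integral_comp_mul {𝕜 : Type*} [RCLike 𝕜] {p : PowerSeries 𝕜} {F : 𝕜 → 𝕜}
    {w u : X → 𝕜} {r R : ℝ} (hp : HasPowerSum p F r) (hw : Integrable w ν)
    (hu : AEStronglyMeasurable u ν) (hR : 0 < R) (huR : ∀ᵐ s ∂ν, ‖u s‖ ≤ R) :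
    HasPowerSum (PowerSeries.mk fun n => p.coeff n * ∫ s, w s * u s ^ n ∂ν)
      (fun h => ∫ s, w s * F (h * u s) ∂ν) (r / R) := fun h hh => by
  have hRh : ‖h‖ * R < r := (lt_div_iff₀ hR).mp hh
  have hterm (n : ℕ) : Integrable (fun s => p.coeff n * (w s * u s ^ n) * h ^ n) ν :=
    ((integrable_mul_pow_of_norm_le hw hu huR n).const_mul _).mul_const _
  have hsummable : Summable fun n => ∫ s, ‖p.coeff n * (w s * u s ^ n) * h ^ n‖ ∂ν := by
    have hmaj : Summable fun n => ‖p.coeff n * ((‖h‖ * R : ℝ) : 𝕜) ^ n‖ * ∫ s, ‖w s‖ ∂ν :=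
      (hp _ (by simpa [abs_of_pos hR] using hRh)).summable.norm.mul_right _
    refine hmaj.of_nonneg_of_le (fun n => by positivity) fun n => ?_
    rw [← integral_const_mul]
    refine integral_mono_ae (hterm n).norm (hw.norm.const_mul _) ?_
    filter_upwards [huR] with s hs
    simp only [norm_mul, norm_pow, RCLike.norm_ofReal, abs_mul, abs_norm, abs_of_pos hR, mul_pow]
    calc ‖p.coeff n‖ * (‖w s‖ * ‖u s‖ ^ n) * ‖h‖ ^ n
        ≤ ‖p.coeff n‖ * (‖w s‖ * R ^ n) * ‖h‖ ^ n := by gcongr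
      _ = ‖p.coeff n‖ * (‖h‖ ^ n * R ^ n) * ‖w s‖ := by ring
  convert! hasSum_integral_of_summable_integral_norm hterm hsummable using 1
  · funext n
    rw [integral_mul_const, integral_const_mul, PowerSeries.coeff_mk]
  · refine integral_congr_ae ?_
    filter_upwards [huR] with s hs
    have hhu : ‖h * u s‖ < r := by
      rw [norm_mul]
      exact (mul_le_mul_of_nonneg_left hs (norm_nonneg h)).trans_lt hRh
    rw [← (hp _ hhu).tsum_eq, ← tsum_mul_left]
    exact tsum_congr fun n => by ring

/-- The power series of `(1 - x)⁻ᵃ`. -/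
noncomputable def negBinomialSeries (a : ℝ) : PowerSeries ℝ :=
  PowerSeries.mk fun n => (ascPochhammer ℝ n).eval a / (n.factorial : ℝ)

theorem hasPowerSum_one_sub_rpow_neg (a : ℝ) :
    HasPowerSum (negBinomialSeries a) (fun x => (1 - x) ^ (-a)) 1 := fun x hx => by
  have h := (Real.one_add_rpow_hasFPowerSeriesOnBall_zero (a := -a)).hasSum (y := -x)
    (by simpa [← ofReal_norm] using hx)
  rw [binomialSeries_eq_ordinaryHypergeometricSeries (b := (1 : ℝ))
    (fun k => by linarith [(k.cast_nonneg : (0 : ℝ) ≤ k)])] at h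
  simp only [zero_add, neg_neg] at h
  rw [show 1 + -x = 1 - x by ring] at h
  refine h.congr_fun fun n => ?_
  have hneg : (⇑(-ContinuousLinearMap.id ℝ ℝ) : ℝ → ℝ) ∘ (fun _ : Fin n => -x) = fun _ => x := by
    funext i
    simp
  have hone : (ascPochhammer ℝ n).eval 1 ≠ 0 := (ascPochhammer_pos n 1 one_pos).ne'
  rw [FormalMultilinearSeries.compContinuousLinearMap_apply, hneg,
    ordinaryHypergeometricSeries_apply_eq, negBinomialSeries, PowerSeries.coeff_mk, smul_eq_mul]
  field_simp

theorem one_sub_mul_pos {z u : ℝ} (hz : z < 1) (hu : u ∈ Icc (0 : ℝ) 1) : 0 < 1 - z * u := by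
  nlinarith [hu.1, hu.2, mul_nonneg hu.1 (sub_nonneg.mpr hz.le)]

variable {w u : X → ℝ}

theorem integrable_mul_one_sub_mul_rpow (hw : Integrable w ν) (hu : AEStronglyMeasurable u ν)
    (hu01 : ∀ᵐ s ∂ν, u s ∈ Icc (0 : ℝ) 1) (a : ℝ) {z : ℝ} (hz : z < 1) :
    Integrable (fun s => w s * (1 - z * u s) ^ (-a)) ν := by
  have hcont : ContinuousOn (fun v : ℝ => (1 - z * v) ^ (-a)) (Icc 0 1) :=
    ContinuousOn.rpow_const (by fun_prop) fun v hv => Or.inl (one_sub_mul_pos hz hv).ne'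
  obtain ⟨C, hC⟩ := isCompact_Icc.exists_bound_of_continuousOn hcont
  refine hw.mul_bdd (c := C) ?_ (hu01.mono fun s hs => hC _ hs)
  exact (((hu.aemeasurable.const_mul z).const_sub 1).pow_const (-a)).aestronglyMeasurable

theorem hasPowerSum_integral_one_sub_mul_rpow (hw : Integrable w ν)
    (hu : AEStronglyMeasurable u ν) (hu01 : ∀ᵐ s ∂ν, u s ∈ Icc (0 : ℝ) 1) (a : ℝ) :
    HasPowerSum (PowerSeries.mk fun n => (negBinomialSeries a).coeff n * ∫ s, w s * u s ^ n ∂ν)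
      (fun z => ∫ s, w s * (1 - z * u s) ^ (-a) ∂ν) 1 := by
  have hbound : ∀ᵐ s ∂ν, ‖u s‖ ≤ 1 := hu01.mono fun s hs => by
    rw [Real.norm_of_nonneg hs.1]
    exact hs.2
  simpa using (hasPowerSum_one_sub_rpow_neg a).integral_comp_mul hw hu one_pos hbound

theorem one_sub_add_mul_rpow {a z h v : ℝ} (hz : z < 1) (hzh : z + h < 1)
    (hv : v ∈ Icc (0 : ℝ) 1) :
    (1 - (z + h) * v) ^ (-a) =
      (1 - z * v) ^ (-a) * (1 - h * (v / (1 - z * v))) ^ (-a) := by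
  have hzv := one_sub_mul_pos hz hv
  have hfactor : 1 - h * (v / (1 - z * v)) = (1 - (z + h) * v) / (1 - z * v) := by
    rw [eq_div_iff hzv.ne', sub_mul, mul_assoc, div_mul_cancel₀ _ hzv.ne']
    ring
  rw [hfactor, Real.div_rpow (one_sub_mul_pos hzh hv).le hzv.le,
    mul_div_cancel₀ _ (Real.rpow_pos_of_pos hzv _).ne']

theorem analyticOnNhd_integral_one_sub_mul_rpow (hw : Integrable w ν)
    (hu : AEStronglyMeasurable u ν) (hu01 : ∀ᵐ s ∂ν, u s ∈ Icc (0 : ℝ) 1) (a : ℝ) :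
    AnalyticOnNhd ℝ (fun z => ∫ s, w s * (1 - z * u s) ^ (-a) ∂ν) (Iio 1) := by
  intro z hz
  have hz' : 0 < 1 - z := sub_pos.mpr hz
  have hmeas : AEStronglyMeasurable (fun s => u s / (1 - z * u s)) ν :=
    (hu.aemeasurable.div ((hu.aemeasurable.const_mul z).const_sub 1)).aestronglyMeasurable
  have hbound : ∀ᵐ s ∂ν, ‖u s / (1 - z * u s)‖ ≤ (1 - z)⁻¹ := hu01.mono fun s hs => by
    have hzu := one_sub_mul_pos hz hs
    rw [Real.norm_of_nonneg (div_nonneg hs.1 hzu.le), div_le_iff₀ hzu, inv_mul_eq_div,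
      le_div_iff₀ hz']
    linarith [hs.2]
  have hsum := (hasPowerSum_one_sub_rpow_neg a).integral_comp_mul
    (integrable_mul_one_sub_mul_rpow hw hu hu01 a hz) hmeas (inv_pos.mpr hz') hbound
  rw [one_div, inv_inv] at hsum
  refine (hsum.congr fun h hh => integral_congr_ae ?_).analyticAt hz'
  filter_upwards [hu01] with s hs
  rw [one_sub_add_mul_rpow hz (by linarith [(abs_lt.mp hh).2]) hs, mul_assoc]

end IntegralOfPowerSeries

section BetaMoments

open ProbabilityTheory

variable {b d p : ℝ}

theorem measurable_betaPDF (b d : ℝ) : Measurable (betaPDF b d) :=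
  (measurable_betaPDFReal b d).ennreal_ofReal

theorem ae_betaMeasure_mem_Ioo (b d : ℝ) : ∀ᵐ s ∂betaMeasure b d, s ∈ Ioo (0 : ℝ) 1 := by
  rw [betaMeasure, ae_withDensity_iff (measurable_betaPDF b d)]
  refine ae_of_all _ fun s hs => ?_
  by_contra h
  exact hs (by rw [betaPDF_eq, if_neg (by simpa using h), ENNReal.ofReal_zero])

theorem betaPDF_mul_rpow (hb : 0 < b) (hd : 0 < d) (hp : 0 < b + p) (s : ℝ) :
    betaPDF b d s * ENNReal.ofReal (s ^ p) =
      ENNReal.ofReal (beta (b + p) d / beta b d) * betaPDF (b + p) d s := by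
  by_cases hs : 0 < s ∧ s < 1
  · rw [betaPDF_of_pos_lt_one hs.1 hs.2, betaPDF_of_pos_lt_one hs.1 hs.2,
      ← ENNReal.ofReal_mul' (Real.rpow_nonneg hs.1.le p),
      ← ENNReal.ofReal_mul (div_pos (beta_pos hp hd) (beta_pos hb hd)).le,
      show b + p - 1 = b - 1 + p by ring, Real.rpow_add hs.1]
    have := (beta_pos hp hd).ne'
    congr 1
    field_simp
  · simp [betaPDF_eq, hs]

theorem lintegral_rpow_betaMeasure (hb : 0 < b) (hd : 0 < d) (hp : 0 < b + p) :
    ∫⁻ s, ENNReal.ofReal (s ^ p) ∂betaMeasure b d =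
      ENNReal.ofReal (beta (b + p) d / beta b d) := by
  rw [betaMeasure, lintegral_withDensity_eq_lintegral_mul _ (measurable_betaPDF b d)
    (by fun_prop)]
  simp only [Pi.mul_apply, betaPDF_mul_rpow hb hd hp]
  rw [lintegral_const_mul _ (measurable_betaPDF _ _),
    lintegral_betaPDF_eq_one hp hd, mul_one]

theorem ae_betaMeasure_rpow_nonneg (b d p : ℝ) : ∀ᵐ s ∂betaMeasure b d, 0 ≤ s ^ p :=
  (ae_betaMeasure_mem_Ioo b d).mono fun _ hs => Real.rpow_nonneg hs.1.le p

theorem integrable_rpow_betaMeasure (hb : 0 < b) (hd : 0 < d) (hp : 0 < b + p) :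
    Integrable (fun s => s ^ p) (betaMeasure b d) := by
  refine ⟨by fun_prop, ?_⟩
  rw [hasFiniteIntegral_iff_ofReal (ae_betaMeasure_rpow_nonneg b d p),
    lintegral_rpow_betaMeasure hb hd hp]
  exact ENNReal.ofReal_lt_top

theorem integral_rpow_betaMeasure (hb : 0 < b) (hd : 0 < d) (hp : 0 < b + p) :
    ∫ s, s ^ p ∂betaMeasure b d = beta (b + p) d / beta b d := by
  rw [integral_eq_lintegral_of_nonneg_ae (ae_betaMeasure_rpow_nonneg b d p) (by fun_prop),
    lintegral_rpow_betaMeasure hb hd hp,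
    ENNReal.toReal_ofReal (div_pos (beta_pos hp hd) (beta_pos hb hd)).le]

theorem gamma_add_nat_eq_ascPochhammer_mul {x : ℝ} (hx : 0 < x) (n : ℕ) :
    Real.Gamma (x + n) = (ascPochhammer ℝ n).eval x * Real.Gamma x := by
  induction n with
  | zero => simp
  | succ n ih =>
    rw [Nat.cast_succ, ← add_assoc, Real.Gamma_add_one (by positivity), ih,
      ascPochhammer_succ_eval]
    ring

theorem integral_pow_betaMeasure (hb : 0 < b) (hd : 0 < d) (n : ℕ) :
    ∫ s, s ^ n ∂betaMeasure b d =
      (ascPochhammer ℝ n).eval b / (ascPochhammer ℝ n).eval (b + d) := by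
  have h := integral_rpow_betaMeasure (p := n) hb hd (by positivity)
  simp only [Real.rpow_natCast] at h
  have := (Real.Gamma_pos_of_pos hb).ne'
  have := (Real.Gamma_pos_of_pos hd).ne'
  have := (Real.Gamma_pos_of_pos (add_pos hb hd)).ne'
  have := (ascPochhammer_pos n _ (add_pos hb hd)).ne'
  rw [h, beta, beta, add_right_comm b, gamma_add_nat_eq_ascPochhammer_mul hb,
    gamma_add_nat_eq_ascPochhammer_mul (add_pos hb hd)]
  field_simp

end BetaMoments

section HypergeometricSeries

open PowerSeries (X C)

variable {𝕜 : Type*} [Field 𝕜]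

/-- Gauss' hypergeometric series `₂F₁(a, b; c; X)` as a formal power series. -/
noncomputable def hypergeometricSeries (a b c : 𝕜) : PowerSeries 𝕜 :=
  PowerSeries.mk (ordinaryHypergeometricCoefficient a b c)

theorem coeff_hypergeometricSeries (a b c : 𝕜) (n : ℕ) :
    (hypergeometricSeries a b c).coeff n =
      (ascPochhammer 𝕜 n).eval a * (ascPochhammer 𝕜 n).eval b /
        ((n.factorial : 𝕜) * (ascPochhammer 𝕜 n).eval c) := by
  rw [hypergeometricSeries, PowerSeries.coeff_mk, ordinaryHypergeometricCoefficient]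
  ring

theorem ascPochhammer_eval_succ_left (n : ℕ) (a : 𝕜) :
    (ascPochhammer 𝕜 (n + 1)).eval a = a * (ascPochhammer 𝕜 n).eval (a + 1) := by
  simp [ascPochhammer_succ_left]

theorem mul_ascPochhammer_eval_add_one (n : ℕ) (a : 𝕜) :
    a * (ascPochhammer 𝕜 n).eval (a + 1) = (ascPochhammer 𝕜 n).eval a * (a + n) := by
  rw [← ascPochhammer_eval_succ_left, ascPochhammer_succ_eval]

theorem ascPochhammer_eval_ne_zero {c : 𝕜} (hc : ∀ n : ℕ, c ≠ -n) (n : ℕ) :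
    (ascPochhammer 𝕜 n).eval c ≠ 0 := by
  rw [Ne, ascPochhammer_eval_eq_zero_iff]
  rintro ⟨k, -, hk⟩
  exact hc k (by rw [hk, neg_neg])

theorem hypergeometricSeries_symm (a b c : 𝕜) :
    hypergeometricSeries a b c = hypergeometricSeries b a c := by
  ext n
  rw [coeff_hypergeometricSeries, coeff_hypergeometricSeries, mul_comm ((ascPochhammer 𝕜 n).eval a)]

theorem coeff_X_mul_derivative (p : PowerSeries 𝕜) (n : ℕ) :
    (X * PowerSeries.derivative 𝕜 p).coeff n = n * p.coeff n := by
  cases n with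
  | zero => simp
  | succ n => simp [PowerSeries.coeff_succ_X_mul, PowerSeries.coeff_derivative, mul_comm]

theorem hypergeometricSeries_add_one_right (a b c : 𝕜) :
    X * PowerSeries.derivative 𝕜 (hypergeometricSeries a b c) + C b * hypergeometricSeries a b c =
      C b * hypergeometricSeries a (b + 1) c := by
  ext n
  rw [map_add, coeff_X_mul_derivative, PowerSeries.coeff_C_mul, PowerSeries.coeff_C_mul,
    coeff_hypergeometricSeries, coeff_hypergeometricSeries]
  linear_combination -(ascPochhammer 𝕜 n).eval a / ((n.factorial : 𝕜) *
    (ascPochhammer 𝕜 n).eval c) * mul_ascPochhammer_eval_add_one n b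

variable [CharZero 𝕜] {a b c : 𝕜}

theorem coeff_succ_hypergeometricSeries (a b : 𝕜) (hc : ∀ n : ℕ, c ≠ -n) (n : ℕ) :
    (n + 1) * (c + n) * (hypergeometricSeries a b c).coeff (n + 1) =
      (a + n) * (b + n) * (hypergeometricSeries a b c).coeff n := by
  have hn : (n.factorial : 𝕜) ≠ 0 := mod_cast n.factorial_ne_zero
  have hn_succ : (n : 𝕜) + 1 ≠ 0 := n.cast_add_one_ne_zero
  have hcn := ascPochhammer_eval_ne_zero hc (n + 1)
  rw [ascPochhammer_succ_eval, mul_ne_zero_iff] at hcn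
  obtain ⟨hcn, hcn_add⟩ := hcn
  rw [coeff_hypergeometricSeries, coeff_hypergeometricSeries, ascPochhammer_succ_eval,
    ascPochhammer_succ_eval, ascPochhammer_succ_eval, Nat.factorial_succ, Nat.cast_mul,
    Nat.cast_succ]
  field_simp

theorem hypergeometricSeries_sub_one_bottom (hc : ∀ n : ℕ, c ≠ -n) :
    X * PowerSeries.derivative 𝕜 (hypergeometricSeries a b (c + 1)) +
      C c * hypergeometricSeries a b (c + 1) = C c * hypergeometricSeries a b c := by
  ext n
  have hn : (n.factorial : 𝕜) ≠ 0 := mod_cast n.factorial_ne_zero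
  have hcn := ascPochhammer_eval_ne_zero hc n
  have hcn_succ := ascPochhammer_eval_ne_zero hc (n + 1)
  rw [ascPochhammer_eval_succ_left, mul_ne_zero_iff] at hcn_succ
  have := hcn_succ.2
  rw [map_add, coeff_X_mul_derivative, PowerSeries.coeff_C_mul, PowerSeries.coeff_C_mul,
    coeff_hypergeometricSeries, coeff_hypergeometricSeries]
  field_simp
  linear_combination -(ascPochhammer 𝕜 n).eval a * (ascPochhammer 𝕜 n).eval b *
    mul_ascPochhammer_eval_add_one n c

theorem derivative_hypergeometricSeries (a b c : 𝕜) :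
    PowerSeries.derivative 𝕜 (hypergeometricSeries a b c) =
      C (a * b / c) * hypergeometricSeries (a + 1) (b + 1) (c + 1) := by
  ext n
  have hn : (n.factorial : 𝕜) ≠ 0 := mod_cast n.factorial_ne_zero
  have hn_succ : (n : 𝕜) + 1 ≠ 0 := n.cast_add_one_ne_zero
  rw [PowerSeries.coeff_derivative, PowerSeries.coeff_C_mul, coeff_hypergeometricSeries,
    coeff_hypergeometricSeries, ascPochhammer_eval_succ_left, ascPochhammer_eval_succ_left,
    ascPochhammer_eval_succ_left, Nat.factorial_succ, Nat.cast_mul, Nat.cast_succ]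
  field_simp

/-- Euler's transformation `₂F₁(a, b; c; z) = (1 - z) ^ (c - a - b) ₂F₁(c - a, c - b; c; z)` in the
case `c - a - b = 1`. -/
theorem one_sub_X_mul_hypergeometricSeries (hc : ∀ n : ℕ, a + b + 1 ≠ -n) :
    (1 - X) * hypergeometricSeries (a + 1) (b + 1) (a + b + 1) =
      hypergeometricSeries a b (a + b + 1) := by
  ext n
  cases n with
  | zero => simp [hypergeometricSeries, ordinaryHypergeometricCoefficient]
  | succ n =>
    have hn : (n.factorial : 𝕜) ≠ 0 := mod_cast n.factorial_ne_zero
    have hn_succ : (n : 𝕜) + 1 ≠ 0 := n.cast_add_one_ne_zero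
    have hcn := ascPochhammer_eval_ne_zero hc (n + 1)
    rw [ascPochhammer_succ_eval, mul_ne_zero_iff] at hcn
    obtain ⟨hcn, hcn_add⟩ := hcn
    rw [sub_mul, one_mul, map_sub, PowerSeries.coeff_succ_X_mul, coeff_hypergeometricSeries,
      coeff_hypergeometricSeries, coeff_hypergeometricSeries, ascPochhammer_eval_succ_left n a,
      ascPochhammer_eval_succ_left n b, ascPochhammer_succ_eval n (a + 1),
      ascPochhammer_succ_eval n (b + 1), ascPochhammer_succ_eval n (a + b + 1),
      Nat.factorial_succ, Nat.cast_mul, Nat.cast_succ]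
    field_simp
    ring

end HypergeometricSeries

section GaussContinuation

variable {a b c : ℝ} {F G : ℝ → ℝ}

theorem one_le_radius_ordinaryHypergeometricSeries (a b c : ℝ) :
    1 ≤ (ordinaryHypergeometricSeries ℝ a b c).radius := by
  by_cases habc : ∀ k : ℕ, ↑k ≠ -a ∧ ↑k ≠ -b ∧ ↑k ≠ -c
  · exact (ordinaryHypergeometricSeries_radius_eq_one ℝ a b c habc).ge
  simp only [not_forall, not_and_or, not_not] at habc
  obtain ⟨k, hk⟩ := habc
  suffices h : (ordinaryHypergeometricSeries ℝ a b c).radius = ⊤ from h ▸ le_top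
  rcases hk with hk | hk | hk
  · rw [← neg_neg a, ← hk, ordinaryHypergeometric_radius_top_of_neg_nat₁]
  · rw [← neg_neg b, ← hk, ordinaryHypergeometric_radius_top_of_neg_nat₂]
  · rw [← neg_neg c, ← hk, ordinaryHypergeometric_radius_top_of_neg_nat₃]

theorem hasPowerSum_ordinaryHypergeometric (a b c : ℝ) :
    HasPowerSum (hypergeometricSeries a b c) (ordinaryHypergeometric a b c) 1 := fun z hz => by
  have hz' : z ∈ Metric.eball 0 (ordinaryHypergeometricSeries ℝ a b c).radius :=
    Metric.eball_subset_eball (one_le_radius_ordinaryHypergeometricSeries a b c)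
      (by simpa [edist_eq_enorm_sub, ← ofReal_norm] using hz)
  refine ((ordinaryHypergeometricSeries ℝ a b c).hasSum hz').congr_fun fun n => ?_
  rw [ordinaryHypergeometricSeries_apply_eq, hypergeometricSeries, PowerSeries.coeff_mk,
    ordinaryHypergeometricCoefficient, smul_eq_mul]

theorem isGaussContinuation_iff :
    IsGaussContinuation a b c F ↔
      AnalyticOnNhd ℝ F (Iio 1) ∧ HasPowerSum (hypergeometricSeries a b c) F 1 :=
  and_congr_right' ⟨fun h => (hasPowerSum_ordinaryHypergeometric a b c).congr fun z hz =>
    (h z hz).symm, fun h z hz => (h z hz).unique (hasPowerSum_ordinaryHypergeometric a b c z hz)⟩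

theorem HasPowerSum.eqOn_Iio {p : PowerSeries ℝ} {s t : ℝ} (hF : HasPowerSum p F s)
    (hG : HasPowerSum p G t) (hs : 0 < s) (ht : 0 < t) (hFa : AnalyticOnNhd ℝ F (Iio 1))
    (hGa : AnalyticOnNhd ℝ G (Iio 1)) : EqOn F G (Iio 1) :=
  hFa.eqOn_of_preconnected_of_eventuallyEq hGa isPreconnected_Iio (mem_Iio.mpr zero_lt_one)
    (hF.eventuallyEq hG hs ht)

theorem HasPowerSum.div_mul_deriv_add {p q : PowerSeries ℝ} {r d : ℝ} (h : HasPowerSum p F r)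
    (hr : 0 < r) (hd : d ≠ 0) (hpq : PowerSeries.X * PowerSeries.derivative ℝ p +
      PowerSeries.C d * p = PowerSeries.C d * q) :
    HasPowerSum q (fun z => z / d * _root_.deriv F z + F z) r := by
  have hsum := (((HasPowerSum.X r).mul (h.deriv hr)).add (h.const_mul d)).const_mul d⁻¹
  rw [hpq, ← mul_assoc, ← map_mul, inv_mul_cancel₀ hd, map_one, one_mul] at hsum
  refine hsum.congr fun z _ => ?_
  field_simp

namespace IsGaussContinuation

theorem symm (h : IsGaussContinuation a b c F) : IsGaussContinuation b a c F := by
  rw [isGaussContinuation_iff, hypergeometricSeries_symm, ← isGaussContinuation_iff]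
  exact h

theorem apply_zero (h : IsGaussContinuation a b c F) : F 0 = 1 := by
  rw [h.2 0 (by simp), ordinaryHypergeometric_zero]

theorem analyticOnNhd_div_mul_deriv_add (h : IsGaussContinuation a b c F) (d : ℝ) :
    AnalyticOnNhd ℝ (fun z => z / d * deriv F z + F z) (Iio 1) :=
  ((analyticOnNhd_id.div_const).mul h.1.deriv).add h.1

theorem sub_one_bottom (hc : ∀ n : ℕ, c ≠ -n) (h : IsGaussContinuation a b (c + 1) F) :
    IsGaussContinuation a b c (fun z => z / c * deriv F z + F z) :=
  isGaussContinuation_iff.mpr ⟨h.analyticOnNhd_div_mul_deriv_add c,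
    (isGaussContinuation_iff.mp h).2.div_mul_deriv_add one_pos (by simpa using hc 0)
      (hypergeometricSeries_sub_one_bottom hc)⟩

theorem add_one_right (hb : b ≠ 0) (h : IsGaussContinuation a b c F) :
    IsGaussContinuation a (b + 1) c (fun z => z / b * deriv F z + F z) :=
  isGaussContinuation_iff.mpr ⟨h.analyticOnNhd_div_mul_deriv_add b,
    (isGaussContinuation_iff.mp h).2.div_mul_deriv_add one_pos hb
      (hypergeometricSeries_add_one_right a b c)⟩

theorem one_sub_mul (hc : ∀ n : ℕ, c ≠ -n) (habc : a + b + 1 = c)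
    (h : IsGaussContinuation (a + 1) (b + 1) c F) :
    IsGaussContinuation a b c (fun z => (1 - z) * F z) := by
  subst habc
  obtain ⟨hFa, hF⟩ := isGaussContinuation_iff.mp h
  rw [isGaussContinuation_iff, ← one_sub_X_mul_hypergeometricSeries hc]
  exact ⟨(analyticOnNhd_const.sub analyticOnNhd_id).mul hFa, (HasPowerSum.one_sub 1).mul hF⟩

theorem deriv_eqOn (hF : IsGaussContinuation a b c F)
    (hG : IsGaussContinuation (a + 1) (b + 1) (c + 1) G) :
    EqOn (deriv F) (fun z => a * b / c * G z) (Iio 1) := by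
  rw [isGaussContinuation_iff] at hF hG
  have hderiv := hF.2.deriv one_pos
  rw [derivative_hypergeometricSeries] at hderiv
  exact hderiv.eqOn_Iio (hG.2.const_mul _) one_pos one_pos hF.1.deriv
    (analyticOnNhd_const.mul hG.1)

end IsGaussContinuation

end GaussContinuation

section EulerIntegral

open ProbabilityTheory

/-- Euler's integral for `₂F₁(a, b; b + d; z)`, as an expectation under the beta distribution with
parameters `b` and `d`. -/
noncomputable def eulerIntegral (a b d z : ℝ) : ℝ := ∫ s, (1 - z * s) ^ (-a) ∂betaMeasure b d

variable {a b d : ℝ}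

theorem ae_betaMeasure_mem_Icc (b d : ℝ) : ∀ᵐ s ∂betaMeasure b d, s ∈ Icc (0 : ℝ) 1 :=
  (ae_betaMeasure_mem_Ioo b d).mono fun _ hs => Ioo_subset_Icc_self hs

theorem isGaussContinuation_eulerIntegral (a : ℝ) (hb : 0 < b) (hd : 0 < d) :
    IsGaussContinuation a b (b + d) (eulerIntegral a b d) := by
  have := isProbabilityMeasureBeta hb hd
  have hsum := hasPowerSum_integral_one_sub_mul_rpow (integrable_const (1 : ℝ))
    aestronglyMeasurable_id (ae_betaMeasure_mem_Icc b d) a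
  have hanalytic := analyticOnNhd_integral_one_sub_mul_rpow (integrable_const (1 : ℝ))
    aestronglyMeasurable_id (ae_betaMeasure_mem_Icc b d) a
  simp only [one_mul, id_eq] at hsum hanalytic
  refine isGaussContinuation_iff.mpr ⟨hanalytic, ?_⟩
  convert! hsum using 1
  ext n
  rw [coeff_hypergeometricSeries, PowerSeries.coeff_mk, integral_pow_betaMeasure hb hd,
    negBinomialSeries, PowerSeries.coeff_mk]
  ring

theorem eulerIntegral_nonneg (a b d : ℝ) {z : ℝ} (hz : z < 1) : 0 ≤ eulerIntegral a b d z :=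
  integral_nonneg_of_ae <| (ae_betaMeasure_mem_Icc b d).mono fun _ hs =>
    Real.rpow_nonneg (one_sub_mul_pos hz hs).le _

theorem one_add_mul_rpow_neg_le {p x s : ℝ} (hp : 0 ≤ p) (hpa : p ≤ a) (hx : 0 ≤ x)
    (hs : s ∈ Ioo (0 : ℝ) 1) : (1 + x * s) ^ (-a) ≤ s ^ (-p) * (1 + x) ^ (-p) := by
  have hxs : 0 ≤ x * s := mul_nonneg hx hs.1.le
  calc (1 + x * s) ^ (-a) ≤ (1 + x * s) ^ (-p) :=
        Real.rpow_le_rpow_of_exponent_le (by linarith) (neg_le_neg hpa)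
    _ ≤ (s * (1 + x)) ^ (-p) :=
        Real.rpow_le_rpow_of_nonpos (mul_pos hs.1 (by linarith)) (by nlinarith [hs.2])
          (neg_nonpos.mpr hp)
    _ = s ^ (-p) * (1 + x) ^ (-p) := Real.mul_rpow hs.1.le (by linarith)

theorem eulerIntegral_neg_le {p x : ℝ} (hb : 0 < b) (hd : 0 < d) (hp : 0 ≤ p) (hpa : p ≤ a)
    (hpb : p < b) (hx : 0 ≤ x) :
    eulerIntegral a b d (-x) ≤ (∫ s, s ^ (-p) ∂betaMeasure b d) * (1 + x) ^ (-p) := by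
  have := isProbabilityMeasureBeta hb hd
  have hint := integrable_mul_one_sub_mul_rpow (integrable_const (1 : ℝ)) aestronglyMeasurable_id
    (ae_betaMeasure_mem_Icc b d) a (z := -x) (by linarith)
  simp only [one_mul, id_eq] at hint
  rw [← integral_mul_const]
  refine integral_mono_ae hint
    ((integrable_rpow_betaMeasure hb hd (by linarith)).mul_const _) ?_
  filter_upwards [ae_betaMeasure_mem_Ioo b d] with s hs
  simpa only [neg_mul, sub_neg_eq_add] using one_add_mul_rpow_neg_le hp hpa hx hs

theorem tendsto_eulerIntegral_neg_atTop (ha : 0 < a) (hb : 0 < b) (hd : 0 < d) :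
    Tendsto (fun x => eulerIntegral a b d (-x)) atTop (𝓝 0) := by
  obtain ⟨p, hp, hpab⟩ := exists_between (lt_min ha hb)
  obtain ⟨hpa, hpb⟩ := lt_min_iff.mp hpab
  have hdecay : Tendsto (fun x : ℝ => (1 + x) ^ (-p)) atTop (𝓝 0) :=
    (tendsto_rpow_neg_atTop hp).comp (tendsto_atTop_add_const_left _ 1 tendsto_id)
  have hmaj := hdecay.const_mul (∫ s, s ^ (-p) ∂betaMeasure b d)
  rw [mul_zero] at hmaj
  refine tendsto_of_tendsto_of_tendsto_of_le_of_le' tendsto_const_nhds hmaj ?_ ?_ <;>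
    filter_upwards [eventually_ge_atTop 0] with x hx
  · exact eulerIntegral_nonneg a b d (by linarith)
  · exact eulerIntegral_neg_le hb hd hp.le hpa.le hpb hx

end EulerIntegral

section GaussFunctions

theorem isGaussContinuation_gauss2F1 {a b c : ℝ} {F : ℝ → ℝ} (hF : IsGaussContinuation a b c F) :
    IsGaussContinuation a b c (gauss2F1 a b c) := by
  have h : ∃ F : ℝ → ℝ, IsGaussContinuation a b c F := ⟨F, hF⟩
  have heq : gauss2F1 a b c = h.choose := funext fun z => dif_pos h
  exact heq ▸ h.choose_spec

/-- `₂F₁(α, -α; 1; -x)`, the sum of the series `f` of part 1. -/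
noncomputable def gaussF (α x : ℝ) : ℝ := gauss2F1 α (-α) 1 (-x)

/-- `₂F₁(1 + α, 1 - α; 2; -x)`; the sum of the series `g` of part 1 is `x` times this function. -/
noncomputable def gaussG (α x : ℝ) : ℝ := gauss2F1 (1 + α) (1 - α) 2 (-x)

/-- `₂F₁(1 + α, 2 - α; 2; -x)`, the solution of the equation of part 2. -/
noncomputable def gaussPhi (α x : ℝ) : ℝ := gauss2F1 (1 + α) (2 - α) 2 (-x)

variable {α x : ℝ}

theorem isGaussContinuation_eulerIntegral_G (hα : α ∈ Ioo (-1 : ℝ) 1) :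
    IsGaussContinuation (1 + α) (1 - α) 2 (eulerIntegral (1 + α) (1 - α) (1 + α)) := by
  convert! isGaussContinuation_eulerIntegral (1 + α) (b := 1 - α) (d := 1 + α)
    (by linarith [hα.2]) (by linarith [hα.1]) using 1
  ring

theorem isGaussContinuation_eulerIntegral_Phi (hα : α ∈ Ioo (-1 : ℝ) 1) :
    IsGaussContinuation (1 + α) (2 - α) 2 (eulerIntegral (2 - α) (1 + α) (1 - α)) := by
  convert! (isGaussContinuation_eulerIntegral (2 - α) (b := 1 + α) (d := 1 - α)
    (by linarith [hα.1]) (by linarith [hα.2])).symm using 1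
  ring

theorem isGaussContinuation_G (hα : α ∈ Ioo (-1 : ℝ) 1) :
    IsGaussContinuation (1 + α) (1 - α) 2 (gauss2F1 (1 + α) (1 - α) 2) :=
  isGaussContinuation_gauss2F1 (isGaussContinuation_eulerIntegral_G hα)

theorem isGaussContinuation_Phi (hα : α ∈ Ioo (-1 : ℝ) 1) :
    IsGaussContinuation (1 + α) (2 - α) 2 (gauss2F1 (1 + α) (2 - α) 2) :=
  isGaussContinuation_gauss2F1 (isGaussContinuation_eulerIntegral_Phi hα)

theorem isGaussContinuation_one_sub_mul_deriv_G (hα : α ∈ Ioo (-1 : ℝ) 1) :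
    IsGaussContinuation α (-α) 1 (fun z => (1 - z) * (z * deriv (gauss2F1 (1 + α) (1 - α) 2) z +
      gauss2F1 (1 + α) (1 - α) 2 z)) := by
  have hone (n : ℕ) : (1 : ℝ) ≠ -n := by linarith [(n.cast_nonneg : (0 : ℝ) ≤ n)]
  have hG := isGaussContinuation_G hα
  rw [← one_add_one_eq_two, add_comm 1 α, sub_eq_neg_add] at hG
  simpa only [div_one, one_add_one_eq_two, add_comm α 1, ← sub_eq_neg_add] using
    (hG.sub_one_bottom hone).one_sub_mul hone (by ring)

theorem isGaussContinuation_F (hα : α ∈ Ioo (-1 : ℝ) 1) :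
    IsGaussContinuation α (-α) 1 (gauss2F1 α (-α) 1) :=
  isGaussContinuation_gauss2F1 (isGaussContinuation_one_sub_mul_deriv_G hα)

theorem analyticAt_gaussG (hα : α ∈ Ioo (-1 : ℝ) 1) (hx : -1 < x) :
    AnalyticAt ℝ (gaussG α) x :=
  ((isGaussContinuation_G hα).1 (-x) (neg_lt.mp hx)).comp analyticAt_id.neg

theorem deriv_gaussG (α x : ℝ) :
    deriv (gaussG α) x = -deriv (gauss2F1 (1 + α) (1 - α) 2) (-x) :=
  deriv_comp_neg (gauss2F1 (1 + α) (1 - α) 2) x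

theorem gaussF_eq (hα : α ∈ Ioo (-1 : ℝ) 1) (hx : -1 < x) :
    gaussF α x = (1 + x) * (x * deriv (gaussG α) x + gaussG α x) := by
  rw [gaussF, gauss2F1_eq (isGaussContinuation_one_sub_mul_deriv_G hα) (neg_lt.mp hx),
    deriv_gaussG, gaussG]
  ring

theorem one_sub_mul_gaussPhi_eq (hα : α ∈ Ioo (-1 : ℝ) 1) (hx : -1 < x) :
    (1 - α) * gaussPhi α x = x * deriv (gaussG α) x + (1 - α) * gaussG α x := by
  have hne : 1 - α ≠ 0 := by linarith [hα.2]
  have h := (isGaussContinuation_G hα).add_one_right hne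
  rw [show 1 - α + 1 = 2 - α by ring] at h
  rw [gaussPhi, gauss2F1_eq h (neg_lt.mp hx), deriv_gaussG, gaussG]
  field_simp

theorem one_sub_mul_gaussPhi (hα : α ∈ Ioo (-1 : ℝ) 1) (hx : -1 < x) :
    (1 - α) * gaussPhi α x = gaussF α x / (1 + x) - α * gaussG α x := by
  have hx' : 1 + x ≠ 0 := by linarith
  rw [one_sub_mul_gaussPhi_eq hα hx, gaussF_eq hα hx, mul_div_cancel_left₀ _ hx']
  ring

theorem hasDerivAt_gaussF (hα : α ∈ Ioo (-1 : ℝ) 1) (hx : -1 < x) :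
    HasDerivAt (gaussF α) (α ^ 2 * gaussG α x) x := by
  have hx' : -x < 1 := neg_lt.mp hx
  have hF := ((isGaussContinuation_F hα).1 (-x) hx').differentiableAt.hasDerivAt
  have hG := isGaussContinuation_G hα
  rw [← one_add_one_eq_two, add_comm 1 α, sub_eq_neg_add] at hG
  rw [(isGaussContinuation_F hα).deriv_eqOn hG hx'] at hF
  convert! hF.comp x (hasDerivAt_neg x) using 1
  rw [gaussG, one_add_one_eq_two, add_comm 1 α, sub_eq_neg_add]
  ring

theorem hasDerivAt_mul_gaussG (hα : α ∈ Ioo (-1 : ℝ) 1) (hx : -1 < x) :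
    HasDerivAt (fun x => x * gaussG α x) (gaussF α x / (1 + x)) x := by
  have h := (hasDerivAt_id' x).mul (analyticAt_gaussG hα hx).differentiableAt.hasDerivAt
  rw [gaussF_eq hα hx, mul_div_cancel_left₀ _ (by linarith), add_comm, ← one_mul (gaussG α x)]
  exact h

theorem gaussF_zero (hα : α ∈ Ioo (-1 : ℝ) 1) : gaussF α 0 = 1 := by
  simpa [gaussF] using (isGaussContinuation_F hα).apply_zero

theorem gaussPhi_zero (hα : α ∈ Ioo (-1 : ℝ) 1) : gaussPhi α 0 = 1 := by
  simpa [gaussPhi] using (isGaussContinuation_Phi hα).apply_zero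

theorem gauss2F1_eq_one_add_mul_gaussPhi (hα : α ∈ Ioo (-1 : ℝ) 1) (hx : -1 < x) :
    gauss2F1 α (1 - α) 2 (-x) = (1 + x) * gaussPhi α x := by
  have htwo (n : ℕ) : (2 : ℝ) ≠ -n := by linarith [(n.cast_nonneg : (0 : ℝ) ≤ n)]
  have hPhi := isGaussContinuation_Phi hα
  rw [add_comm 1 α, show 2 - α = 1 - α + 1 by ring] at hPhi
  rw [gauss2F1_eq (hPhi.one_sub_mul htwo (by ring)) (neg_lt.mp hx), sub_neg_eq_add, gaussPhi,
    add_comm 1 α, show 2 - α = 1 - α + 1 by ring]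

theorem gaussG_eq_eulerIntegral (hα : α ∈ Ioo (-1 : ℝ) 1) (hx : -1 < x) :
    gaussG α x = eulerIntegral (1 + α) (1 - α) (1 + α) (-x) :=
  gauss2F1_eq (isGaussContinuation_eulerIntegral_G hα) (neg_lt.mp hx)

theorem gaussPhi_eq_eulerIntegral (hα : α ∈ Ioo (-1 : ℝ) 1) (hx : -1 < x) :
    gaussPhi α x = eulerIntegral (2 - α) (1 + α) (1 - α) (-x) :=
  gauss2F1_eq (isGaussContinuation_eulerIntegral_Phi hα) (neg_lt.mp hx)

end GaussFunctions

section Decay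

variable {α x : ℝ}

theorem analyticAt_gaussPhi (hα : α ∈ Ioo (-1 : ℝ) 1) (hx : -1 < x) :
    AnalyticAt ℝ (gaussPhi α) x :=
  ((isGaussContinuation_Phi hα).1 (-x) (neg_lt.mp hx)).comp analyticAt_id.neg

theorem aestronglyMeasurable_gaussPhi (hα : α ∈ Ioo (-1 : ℝ) 1) :
    AEStronglyMeasurable (gaussPhi α) (volume.restrict (Ioi 0)) :=
  ContinuousOn.aestronglyMeasurable (fun _ hx => (analyticAt_gaussPhi hα
    (neg_one_lt_zero.trans hx)).continuousAt.continuousWithinAt) measurableSet_Ioi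

theorem memLp_one_add_rpow_neg {p : ℝ} (hp : 1 / 2 < p) :
    MemLp (fun t : ℝ => (1 + t) ^ (-p)) 2 (volume.restrict (Ioi 0)) := by
  rw [memLp_two_iff_integrable_sq (Measurable.aestronglyMeasurable (by fun_prop))]
  have hint := integrableOn_add_rpow_Ioi_of_lt (a := -(2 * p)) (c := 0) (m := 1) (by linarith)
    (by norm_num)
  refine hint.congr_fun (fun t ht => ?_) measurableSet_Ioi
  have ht' : 0 ≤ 1 + t := by linarith [mem_Ioi.mp ht]
  simp only [add_comm t 1, ← Real.rpow_natCast, ← Real.rpow_mul ht']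
  congr 1
  push_cast
  ring

theorem memLp_gaussPhi (hα : α ∈ Ioc (-(1 / 2) : ℝ) (1 / 2)) :
    MemLp (gaussPhi α) 2 (volume.restrict (Ioi 0)) := by
  have hα' : α ∈ Ioo (-1 : ℝ) 1 := ⟨by linarith [hα.1], by linarith [hα.2]⟩
  have hmin : 1 / 2 < min 1 (1 + α) := lt_min (by norm_num) (by linarith [hα.1])
  obtain ⟨p, hp, hpmin⟩ := exists_between hmin
  obtain ⟨hp_one, hpα⟩ := lt_min_iff.mp hpmin
  refine (memLp_one_add_rpow_neg hp).of_le_mul (aestronglyMeasurable_gaussPhi hα') ?_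
    (c := ∫ s, s ^ (-p) ∂ProbabilityTheory.betaMeasure (1 + α) (1 - α))
  filter_upwards [ae_restrict_mem measurableSet_Ioi] with t ht
  have ht' : 0 < t := ht
  rw [gaussPhi_eq_eulerIntegral hα' (by linarith),
    Real.norm_of_nonneg (eulerIntegral_nonneg _ _ _ (by linarith)),
    Real.norm_of_nonneg (by positivity)]
  exact eulerIntegral_neg_le (by linarith) (by linarith [hα'.2]) (by linarith)
    (by linarith [hα.2]) hpα ht'.le

theorem tendsto_gaussPhi_atTop (hα : α ∈ Ioo (-1 : ℝ) 1) :
    Tendsto (gaussPhi α) atTop (𝓝 0) := by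
  refine (tendsto_eulerIntegral_neg_atTop (a := 2 - α) (b := 1 + α) (d := 1 - α)
    (by linarith [hα.2]) (by linarith [hα.1]) (by linarith [hα.2])).congr' ?_
  filter_upwards [eventually_ge_atTop 0] with x hx
  rw [gaussPhi_eq_eulerIntegral hα (by linarith)]

theorem tendsto_gaussG_atTop (hα : α ∈ Ioo (-1 : ℝ) 1) : Tendsto (gaussG α) atTop (𝓝 0) := by
  refine (tendsto_eulerIntegral_neg_atTop (a := 1 + α) (b := 1 - α) (d := 1 + α)
    (by linarith [hα.1]) (by linarith [hα.2]) (by linarith [hα.1])).congr' ?_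
  filter_upwards [eventually_ge_atTop 0] with x hx
  rw [gaussG_eq_eulerIntegral hα (by linarith)]

/-- `f(x) - α g(x)`, the derivative of `x (1 + x) ₂F₁(1 + α, 2 - α; 2; -x)`. -/
noncomputable def gaussW (α x : ℝ) : ℝ := gaussF α x - α * (x * gaussG α x)

theorem gaussW_zero (hα : α ∈ Ioo (-1 : ℝ) 1) : gaussW α 0 = 1 := by
  simp [gaussW, gaussF_zero hα]

theorem hasDerivAt_gaussW (hα : α ∈ Ioo (-1 : ℝ) 1) (hx : -1 < x) :
    HasDerivAt (gaussW α) (-(α * (1 - α)) * gaussPhi α x) x := by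
  have h := (hasDerivAt_gaussF hα hx).sub ((hasDerivAt_mul_gaussG hα hx).const_mul α)
  convert! h using 1
  linear_combination -α * one_sub_mul_gaussPhi hα hx

theorem hasDerivAt_mul_gaussPhi (hα : α ∈ Ioo (-1 : ℝ) 1) (hx : -1 < x) :
    HasDerivAt (fun x => x * (1 + x) * gaussPhi α x) (gaussW α x) x := by
  have hne : 1 - α ≠ 0 := by linarith [hα.2]
  have hx' : 1 + x ≠ 0 := by linarith
  have hrhs : HasDerivAt (fun y => (1 - α)⁻¹ * (y * gaussF α y - α * ((1 + y) * (y * gaussG α y))))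
      (gaussW α x) x := by
    have hone : HasDerivAt (fun y : ℝ => 1 + y) 1 x := (hasDerivAt_id' x).const_add 1
    convert! ((((hasDerivAt_id' x).mul (hasDerivAt_gaussF hα hx)).sub
      ((hone.mul (hasDerivAt_mul_gaussG hα hx)).const_mul α)).const_mul (1 - α)⁻¹) using 1
    rw [gaussW]
    field_simp
    ring
  refine hrhs.congr_of_eventuallyEq ?_
  filter_upwards [Ioi_mem_nhds hx] with y hy
  have hy' : 1 + y ≠ 0 := by linarith [mem_Ioi.mp hy]
  have hPhi := one_sub_mul_gaussPhi hα hy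
  field_simp at hPhi ⊢
  linear_combination y * hPhi

theorem tendsto_gaussW_div_atTop (hα : α ∈ Ioo (-1 : ℝ) 1) :
    Tendsto (fun x => gaussW α x / (1 + x)) atTop (𝓝 0) := by
  have hdecay : Tendsto (fun x : ℝ => (1 + x)⁻¹) atTop (𝓝 0) :=
    tendsto_inv_atTop_zero.comp (tendsto_atTop_add_const_left _ 1 tendsto_id)
  have h := ((tendsto_gaussPhi_atTop hα).const_mul (1 - α)).add
    (((tendsto_gaussG_atTop hα).mul hdecay).const_mul α)
  simp only [mul_zero, add_zero] at h
  refine h.congr' ?_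
  filter_upwards [eventually_ge_atTop 0] with x hx
  have hx' : 1 + x ≠ 0 := by linarith
  rw [one_sub_mul_gaussPhi hα (by linarith), gaussW]
  field_simp
  ring

end Decay

section StieltjesTransform

/-- The `n`-th Taylor coefficient at `z = 0` of the Stieltjes transform `∫₀^∞ ψ(t) / (1 + t - z) dt`
of `ψ`. -/
noncomputable def stieltjesMoment (ψ : ℝ → ℝ) (n : ℕ) : ℝ :=
  ∫ t in Ioi (0 : ℝ), ψ t / (1 + t) * (1 + t)⁻¹ ^ n

variable {ψ W : ℝ → ℝ} {κ t : ℝ}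

theorem inv_one_add_mem_Ioo (ht : 0 < t) : (1 + t)⁻¹ ∈ Ioo (0 : ℝ) 1 :=
  ⟨by positivity, inv_lt_one_of_one_lt₀ (by linarith)⟩

theorem ae_inv_one_add_mem_Ioo :
    ∀ᵐ t ∂volume.restrict (Ioi (0 : ℝ)), (1 + t)⁻¹ ∈ Ioo (0 : ℝ) 1 :=
  (ae_restrict_mem measurableSet_Ioi).mono fun _ ht => inv_one_add_mem_Ioo ht

theorem ae_inv_one_add_mem_Icc :
    ∀ᵐ t ∂volume.restrict (Ioi (0 : ℝ)), (1 + t)⁻¹ ∈ Icc (0 : ℝ) 1 :=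
  ae_inv_one_add_mem_Ioo.mono fun _ ht => Ioo_subset_Icc_self ht

theorem aestronglyMeasurable_inv_one_add {ν : Measure ℝ} :
    AEStronglyMeasurable (fun t : ℝ => (1 + t)⁻¹) ν :=
  Measurable.aestronglyMeasurable (by fun_prop)

theorem coeff_negBinomialSeries_one (n : ℕ) : (negBinomialSeries 1).coeff n = 1 := by
  rw [negBinomialSeries, PowerSeries.coeff_mk, ascPochhammer_eval_one,
    div_self (by positivity)]

theorem div_one_add_mul_rpow_neg_one {z : ℝ} (hz : z < 1) (c : ℝ) (ht : 0 < t) :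
    c / (1 + t) * (1 - z * (1 + t)⁻¹) ^ (-1 : ℝ) = c / (1 + t - z) := by
  have hzt : 1 + t - z ≠ 0 := by linarith
  have hfactor : 1 - z * (1 + t)⁻¹ = (1 + t - z) / (1 + t) := by field_simp
  rw [Real.rpow_neg_one, hfactor, inv_div]
  field_simp

theorem setIntegral_div_one_add_mul_rpow_neg_one (ψ : ℝ → ℝ) {z : ℝ} (hz : z < 1) :
    ∫ t in Ioi (0 : ℝ), ψ t / (1 + t) * (1 - z * (1 + t)⁻¹) ^ (-1 : ℝ) =
      ∫ t in Ioi (0 : ℝ), ψ t / (1 + t - z) :=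
  setIntegral_congr_fun measurableSet_Ioi fun t ht => div_one_add_mul_rpow_neg_one hz (ψ t) ht

theorem integrableOn_div_one_add_sub (hψ : IntegrableOn (fun t => ψ t / (1 + t)) (Ioi 0)) {z : ℝ}
    (hz : z < 1) : IntegrableOn (fun t => ψ t / (1 + t - z)) (Ioi 0) :=
  IntegrableOn.congr_fun (integrable_mul_one_sub_mul_rpow hψ aestronglyMeasurable_inv_one_add
    ae_inv_one_add_mem_Icc 1 hz) (fun t ht => div_one_add_mul_rpow_neg_one hz (ψ t) ht)
    measurableSet_Ioi

theorem hasPowerSum_stieltjesTransform (hψ : IntegrableOn (fun t => ψ t / (1 + t)) (Ioi 0)) :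
    HasPowerSum (PowerSeries.mk (stieltjesMoment ψ))
      (fun z => ∫ t in Ioi (0 : ℝ), ψ t / (1 + t - z)) 1 := by
  have h := hasPowerSum_integral_one_sub_mul_rpow hψ aestronglyMeasurable_inv_one_add
    ae_inv_one_add_mem_Icc 1
  simp only [coeff_negBinomialSeries_one, one_mul] at h
  exact h.congr fun z hz => setIntegral_div_one_add_mul_rpow_neg_one ψ (abs_lt.mp hz).2

theorem analyticOnNhd_stieltjesTransform
    (hψ : IntegrableOn (fun t => ψ t / (1 + t)) (Ioi 0)) :
    AnalyticOnNhd ℝ (fun z => ∫ t in Ioi (0 : ℝ), ψ t / (1 + t - z)) (Iio 1) :=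
  (analyticOnNhd_integral_one_sub_mul_rpow hψ aestronglyMeasurable_inv_one_add
    ae_inv_one_add_mem_Icc 1).congr isOpen_Iio fun _ hz =>
      setIntegral_div_one_add_mul_rpow_neg_one ψ hz

theorem integrableOn_div_one_add_mul_pow (hψ : IntegrableOn (fun t => ψ t / (1 + t)) (Ioi 0))
    (n : ℕ) : IntegrableOn (fun t => ψ t / (1 + t) * (1 + t)⁻¹ ^ n) (Ioi 0) := by
  refine integrable_mul_pow_of_norm_le (R := 1) hψ aestronglyMeasurable_inv_one_add ?_ n
  filter_upwards [ae_inv_one_add_mem_Ioo] with t ht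
  rw [Real.norm_of_nonneg ht.1.le]
  exact ht.2.le

theorem tendsto_stieltjesMoment (hψ : IntegrableOn (fun t => ψ t / (1 + t)) (Ioi 0)) :
    Tendsto (stieltjesMoment ψ) atTop (𝓝 0) := by
  rw [← integral_zero ℝ ℝ (μ := volume.restrict (Ioi 0))]
  refine tendsto_integral_of_dominated_convergence (fun t => ‖ψ t / (1 + t)‖)
    (fun n => (integrableOn_div_one_add_mul_pow hψ n).aestronglyMeasurable) hψ.norm
    (fun n => ?_) ?_ <;> filter_upwards [ae_inv_one_add_mem_Ioo] with t ht
  · rw [norm_mul, norm_pow, Real.norm_of_nonneg ht.1.le]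
    exact mul_le_of_le_one_right (norm_nonneg _) (pow_le_one₀ ht.1.le ht.2.le)
  · simpa using (tendsto_pow_atTop_nhds_zero_of_lt_one ht.1.le ht.2).const_mul (ψ t / (1 + t))

theorem hasDerivAt_inv_one_add_pow (ht : 1 + t ≠ 0) (n : ℕ) :
    HasDerivAt (fun t : ℝ => (1 + t)⁻¹ ^ n) (-n * (1 + t)⁻¹ ^ (n + 1)) t := by
  have h := (((hasDerivAt_id' t).const_add 1).inv ht).pow n
  convert! h using 1
  cases n with
  | zero => simp
  | succ n =>
    simp only [Nat.add_sub_cancel, Pi.inv_apply, pow_succ]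
    field_simp

/- The primitive comes from integrating `ψ(t) (1 + t)^(-n-1)` by parts twice against the equation
`(t (1 + t) ψ)'' = -κ ψ`, which `W` splits into a first-order system. -/
theorem hasDerivAt_stieltjesMoment_primitive (ht : 0 ≤ t)
    (hψ : HasDerivAt (fun t => t * (1 + t) * ψ t) (W t) t) (hW : HasDerivAt W (-κ * ψ t) t)
    (n : ℕ) :
    HasDerivAt (fun t => (n + 1) * (t * (1 + t) * ψ t * (1 + t)⁻¹ ^ (n + 2)) +
        W t * (1 + t)⁻¹ ^ (n + 1))
      (-((n + 1) * (n + 2) + κ) * (ψ t / (1 + t) * (1 + t)⁻¹ ^ n) +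
        (n + 1) * (n + 2) * (ψ t / (1 + t) * (1 + t)⁻¹ ^ (n + 1))) t := by
  have ht' : 1 + t ≠ 0 := by positivity
  convert! ((hψ.mul (hasDerivAt_inv_one_add_pow ht' (n + 2))).const_mul ((n : ℝ) + 1)).add
    (hW.mul (hasDerivAt_inv_one_add_pow ht' (n + 1))) using 1
  simp only [Nat.cast_add, Nat.cast_one, Nat.cast_ofNat, pow_succ]
  field_simp
  ring

theorem tendsto_stieltjesMoment_primitive (hψ : Tendsto ψ atTop (𝓝 0))
    (hW : Tendsto (fun t => W t / (1 + t)) atTop (𝓝 0)) (n : ℕ) :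
    Tendsto (fun t => (n + 1) * (t * (1 + t) * ψ t * (1 + t)⁻¹ ^ (n + 2)) +
      W t * (1 + t)⁻¹ ^ (n + 1)) atTop (𝓝 0) := by
  have hinv : Tendsto (fun t : ℝ => (1 + t)⁻¹) atTop (𝓝 0) :=
    tendsto_inv_atTop_zero.comp (tendsto_atTop_add_const_left _ 1 tendsto_id)
  have h := (((hψ.mul (hinv.const_sub 1)).const_mul ((n : ℝ) + 1)).add hW).mul (hinv.pow n)
  simp only [zero_mul, mul_zero, add_zero] at h
  refine h.congr' ?_
  filter_upwards [eventually_gt_atTop 0] with t ht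
  simp only [pow_succ]
  field_simp
  ring

theorem stieltjesMoment_succ (hint : IntegrableOn (fun t => ψ t / (1 + t)) (Ioi 0))
    (hψ : ∀ t, 0 ≤ t → HasDerivAt (fun t => t * (1 + t) * ψ t) (W t) t)
    (hW : ∀ t, 0 ≤ t → HasDerivAt W (-κ * ψ t) t) (hψ_lim : Tendsto ψ atTop (𝓝 0))
    (hW_lim : Tendsto (fun t => W t / (1 + t)) atTop (𝓝 0)) (n : ℕ) :
    (n + 1) * (n + 2) * stieltjesMoment ψ (n + 1) =
      ((n + 1) * (n + 2) + κ) * stieltjesMoment ψ n - W 0 := by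
  have hint_n :=
    (integrableOn_div_one_add_mul_pow hint n).const_mul (-(((n : ℝ) + 1) * (n + 2) + κ))
  have hint_succ :=
    (integrableOn_div_one_add_mul_pow hint (n + 1)).const_mul (((n : ℝ) + 1) * (n + 2))
  have h := integral_Ioi_of_hasDerivAt_of_tendsto'
    (fun t ht => hasDerivAt_stieltjesMoment_primitive ht (hψ t ht) (hW t ht) n)
    (hint_n.add hint_succ) (tendsto_stieltjesMoment_primitive hψ_lim hW_lim n)
  rw [integral_add hint_n hint_succ, integral_const_mul, integral_const_mul,
    ← stieltjesMoment, ← stieltjesMoment] at h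
  simp only [zero_mul, mul_zero, zero_add, add_zero, inv_one, one_pow, mul_one] at h
  linear_combination h

end StieltjesTransform

section Asymptotics

theorem prod_range_add_eq_ascPochhammer_eval (a : ℝ) (n : ℕ) :
    ∏ j ∈ Finset.range n, (a + j) = (ascPochhammer ℝ n).eval a := by
  induction n with
  | zero => simp
  | succ n ih => rw [Finset.prod_range_succ, ih, ascPochhammer_succ_eval]

theorem tendsto_ascPochhammer_div {a : ℝ} (ha : ∀ n : ℕ, a ≠ -n) :
    Tendsto (fun n : ℕ => (ascPochhammer ℝ n).eval a / (n.factorial * (n : ℝ) ^ (a - 1)))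
      atTop (𝓝 (Real.Gamma a)⁻¹) := by
  have hratio : Tendsto (fun n : ℕ => (n : ℝ) / (a + n)) atTop (𝓝 1) := by
    simpa [add_comm] using tendsto_natCast_div_add_atTop (𝕜 := ℝ) a
  have h := ((Real.GammaSeq_tendsto_Gamma a).inv₀ (Real.Gamma_ne_zero ha)).mul hratio
  rw [mul_one] at h
  refine h.congr' ?_
  filter_upwards [eventually_gt_atTop 0] with n hn
  have hn' : (0 : ℝ) < n := mod_cast hn
  have han : a + n ≠ 0 := fun h0 => ha n (eq_neg_of_add_eq_zero_left h0)
  rw [Real.GammaSeq, prod_range_add_eq_ascPochhammer_eval, ascPochhammer_succ_eval,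
    Real.rpow_sub_one hn'.ne']
  field_simp

theorem tendsto_coeff_hypergeometricSeries {a b c : ℝ} (habc : a + b = c + 1)
    (ha : ∀ n : ℕ, a ≠ -n) (hb : ∀ n : ℕ, b ≠ -n) (hc : ∀ n : ℕ, c ≠ -n) :
    Tendsto (fun n => (hypergeometricSeries a b c).coeff n) atTop
      (𝓝 (Real.Gamma c / (Real.Gamma a * Real.Gamma b))) := by
  have h := ((tendsto_ascPochhammer_div ha).mul (tendsto_ascPochhammer_div hb)).div
    (tendsto_ascPochhammer_div hc) (inv_ne_zero (Real.Gamma_ne_zero hc))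
  rw [div_inv_eq_mul, ← mul_inv, inv_mul_eq_div] at h
  refine h.congr' ?_
  filter_upwards [eventually_gt_atTop 0] with n hn
  have hn' : (0 : ℝ) < n := mod_cast hn
  have hpow : (n : ℝ) ^ (a - 1) * (n : ℝ) ^ (b - 1) = (n : ℝ) ^ (c - 1) := by
    rw [← Real.rpow_add hn']
    congr 1
    linear_combination habc
  have := ascPochhammer_eval_ne_zero hc n
  have := (Real.rpow_pos_of_pos hn' (a - 1)).ne'
  have := (Real.rpow_pos_of_pos hn' (b - 1)).ne'
  simp only [Pi.div_apply, ← hpow]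
  rw [coeff_hypergeometricSeries]
  field_simp

theorem eq_zero_of_recurrence_of_tendsto {r s u v : ℕ → ℝ} {C : ℝ} (hr : ∀ n, r n ≠ 0)
    (hu : ∀ n, r n * u (n + 1) = s n * u n) (hv : ∀ n, r n * v (n + 1) = s n * v n)
    (hu_zero : u 0 ≠ 0) (hC : C ≠ 0) (hu_lim : Tendsto u atTop (𝓝 C))
    (hv_lim : Tendsto v atTop (𝓝 0)) (n : ℕ) : v n = 0 := by
  have hprop (n : ℕ) : u 0 * v n = v 0 * u n := by
    induction n with
    | zero => ring
    | succ n ih =>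
      refine mul_left_cancel₀ (hr n) ?_
      linear_combination u 0 * hv n - v 0 * hu n + s n * ih
  have hlim : u 0 * 0 = v 0 * C :=
    tendsto_nhds_unique ((hv_lim.const_mul (u 0)).congr hprop) (hu_lim.const_mul (v 0))
  have hv_zero : v 0 = 0 := by simpa [hC] using hlim.symm
  have hn := hprop n
  rw [hv_zero, zero_mul] at hn
  exact (mul_eq_zero.mp hn).resolve_left hu_zero

end Asymptotics

section IntegralEquation

/-- `1 / (Γ(1 + α) Γ(2 - α))`, the limit of the Taylor coefficients of `₂F₁(1 + α, 2 - α; 2; z)`;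
this is `c_λ` expressed through `α`. -/
noncomputable def gaussPhiConst (α : ℝ) : ℝ := (Real.Gamma (1 + α) * Real.Gamma (2 - α))⁻¹

variable {α x : ℝ}

theorem gaussPhiConst_pos (hα : α ∈ Ioo (-1 : ℝ) 1) : 0 < gaussPhiConst α :=
  inv_pos.mpr (mul_pos (Real.Gamma_pos_of_pos (by linarith [hα.1]))
    (Real.Gamma_pos_of_pos (by linarith [hα.2])))

theorem mul_gaussPhiConst (hα : α ∈ Ioo (-1 : ℝ) 1) :
    α * (1 - α) * gaussPhiConst α = Real.sin (Real.pi * α) / Real.pi := by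
  rcases eq_or_ne α 0 with rfl | hα_zero
  · simp
  have hα_one : 1 - α ≠ 0 := by linarith [hα.2]
  have := Real.Gamma_pos_of_pos (show 0 < 1 - α by linarith [hα.2])
  have hΓ : Real.Gamma α ≠ 0 := by
    intro h
    have := Real.Gamma_pos_of_pos (show 0 < α + 1 by linarith [hα.1])
    rw [Real.Gamma_add_one hα_zero, h, mul_zero] at this
    exact this.false
  rw [gaussPhiConst, add_comm 1 α, show 2 - α = 1 - α + 1 by ring, Real.Gamma_add_one hα_zero,
    Real.Gamma_add_one hα_one, ← inv_div, ← Real.Gamma_mul_Gamma_one_sub]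
  field_simp

theorem coeff_gaussPhi_eq (hα : α ∈ Ioo (-1 : ℝ) 1)
    (hint : IntegrableOn (fun t => gaussPhi α t / (1 + t)) (Ioi 0)) (n : ℕ) :
    (hypergeometricSeries (1 + α) (2 - α) 2).coeff n +
      α * (1 - α) * gaussPhiConst α * stieltjesMoment (gaussPhi α) n = gaussPhiConst α := by
  have hpos {a : ℝ} (ha : 0 < a) (n : ℕ) : a ≠ -n := by
    linarith [(n.cast_nonneg : (0 : ℝ) ≤ n)]
  have hcoeff := tendsto_coeff_hypergeometricSeries (a := 1 + α) (b := 2 - α) (c := 2) (by ring)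
    (hpos (by linarith [hα.1])) (hpos (by linarith [hα.2])) (hpos two_pos)
  rw [Real.Gamma_two, one_div, ← gaussPhiConst] at hcoeff
  have hmoment (n : ℕ) := stieltjesMoment_succ hint
    (fun t ht => hasDerivAt_mul_gaussPhi hα (neg_one_lt_zero.trans_le ht))
    (fun t ht => hasDerivAt_gaussW hα (neg_one_lt_zero.trans_le ht))
    (tendsto_gaussPhi_atTop hα) (tendsto_gaussW_div_atTop hα) n
  rw [gaussW_zero hα] at hmoment
  have hseries (n : ℕ) := coeff_succ_hypergeometricSeries (1 + α) (2 - α) (hpos two_pos) n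
  refine sub_eq_zero.mp (eq_zero_of_recurrence_of_tendsto (r := fun n => (n + 1) * (2 + n))
    (v := fun n => (hypergeometricSeries (1 + α) (2 - α) 2).coeff n +
      α * (1 - α) * gaussPhiConst α * stieltjesMoment (gaussPhi α) n - gaussPhiConst α)
    (fun n => by positivity) hseries (fun n => ?_) ?_ (gaussPhiConst_pos hα).ne' hcoeff ?_ n)
  · linear_combination hseries n + α * (1 - α) * gaussPhiConst α * hmoment n
  · simp [coeff_hypergeometricSeries]
  · simpa using (hcoeff.add ((tendsto_stieltjesMoment hint).const_mul
      (α * (1 - α) * gaussPhiConst α))).sub_const (gaussPhiConst α)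

theorem gaussPhi_eq_sub_integral (hα : α ∈ Ioo (-1 : ℝ) 1)
    (hint : IntegrableOn (fun t => gaussPhi α t / (1 + t)) (Ioi 0)) (hx : -1 < x) :
    gaussPhi α x = gaussPhiConst α / (1 + x) - α * (1 - α) * gaussPhiConst α *
      ∫ t in Ioi (0 : ℝ), gaussPhi α t / (1 + t + x) := by
  obtain ⟨hPhi_analytic, hPhi⟩ := isGaussContinuation_iff.mp (isGaussContinuation_Phi hα)
  have hsum := (HasPowerSum.one_sub 1).mul (hPhi.add
    ((hasPowerSum_stieltjesTransform hint).const_mul (α * (1 - α) * gaussPhiConst α)))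
  have hseries : hypergeometricSeries (1 + α) (2 - α) 2 +
      PowerSeries.C (α * (1 - α) * gaussPhiConst α) *
        PowerSeries.mk (stieltjesMoment (gaussPhi α)) =
      PowerSeries.C (gaussPhiConst α) * PowerSeries.mk 1 := by
    ext n
    rw [map_add, PowerSeries.coeff_C_mul, PowerSeries.coeff_mk, coeff_gaussPhi_eq hα hint n,
      PowerSeries.coeff_C_mul, PowerSeries.coeff_mk, Pi.one_apply, mul_one]
  rw [hseries, mul_left_comm, mul_comm (1 - _), PowerSeries.mk_one_mul_one_sub_eq_one,
    mul_one] at hsum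
  have heq := hsum.eqOn_Iio (HasPowerSum.const (gaussPhiConst α) 1) one_pos one_pos
    ((analyticOnNhd_const.sub analyticOnNhd_id).mul (hPhi_analytic.add
      (analyticOnNhd_const.mul (analyticOnNhd_stieltjesTransform hint))))
    analyticOnNhd_const (neg_lt.mp hx)
  simp only [sub_neg_eq_add] at heq
  have hx_ne : 1 + x ≠ 0 := by linarith
  rw [eq_sub_iff_add_eq, eq_div_iff hx_ne, gaussPhi]
  linear_combination heq

end IntegralEquation

section SchurTest

variable {X : Type*} [MeasurableSpace X] {ν : Measure X}

/- Weighted AM-GM, `2 f(x) f(y) ≤ f(x)² p(x) / p(y) + f(y)² p(y) / p(x)`, integrated against the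
symmetric kernel. -/
theorem lintegral_lintegral_enorm_mul_mul_le [SFinite ν] {K : X → X → ℝ} {f p : X → ℝ}
    (hK : Measurable (Function.uncurry K)) (hK_symm : ∀ x y, K x y = K y x)
    (hf : AEMeasurable f ν) (hp : Measurable p) (hp_ne : ∀ᵐ x ∂ν, p x ≠ 0) :
    ∫⁻ x, ∫⁻ y, ‖K x y * f x * f y‖ₑ ∂ν ∂ν ≤
      ∫⁻ x, ∫⁻ y, ‖f x ^ 2 * (K x y * (p x / p y))‖ₑ ∂ν ∂ν := by
  let A (x y : X) : ENNReal := ‖f x ^ 2 * (K x y * (p x / p y))‖ₑ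
  have hA : AEMeasurable (Function.uncurry A) (ν.prod ν) :=
    ((hf.comp_fst.pow_const 2).mul (hK.mul ((hp.comp measurable_fst).div
      (hp.comp measurable_snd))).aemeasurable).enorm
  have hpt (x y : X) (hx : p x ≠ 0) (hy : p y ≠ 0) :
      2 * ‖K x y * f x * f y‖ₑ ≤ A x y + A y x := by
    have := norm_pos_iff.mpr hx
    have := norm_pos_iff.mpr hy
    simp only [A, hK_symm y x, enorm_eq_nnnorm]
    norm_cast
    rw [← NNReal.coe_le_coe]
    push_cast
    simp only [norm_mul, norm_div, norm_pow]
    have hsq : 2 * (‖f x‖ * ‖f y‖) ≤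
        ‖f x‖ ^ 2 * (‖p x‖ / ‖p y‖) + ‖f y‖ ^ 2 * (‖p y‖ / ‖p x‖) := by
      rw [← sub_nonneg, show _ - _ = (‖f x‖ * ‖p x‖ - ‖f y‖ * ‖p y‖) ^ 2 / (‖p x‖ * ‖p y‖) by
        field_simp; ring]
      positivity
    linarith [mul_le_mul_of_nonneg_left hsq (norm_nonneg (K x y))]
  have hswap : ∫⁻ x, ∫⁻ y, A y x ∂ν ∂ν = ∫⁻ x, ∫⁻ y, A x y ∂ν ∂ν :=
    lintegral_lintegral_swap (f := fun x y => A y x) hA.prod_swap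
  have hsum : 2 * ∫⁻ x, ∫⁻ y, ‖K x y * f x * f y‖ₑ ∂ν ∂ν ≤ 2 * ∫⁻ x, ∫⁻ y, A x y ∂ν ∂ν := by
    rw [two_mul (∫⁻ x, ∫⁻ y, A x y ∂ν ∂ν)]
    nth_rw 2 [← hswap]
    have hA_inner : AEMeasurable (fun x => ∫⁻ y, A x y ∂ν) ν := hA.lintegral_prod_right'
    rw [← lintegral_add_left' hA_inner, ← lintegral_const_mul' _ _ (by finiteness)]
    refine lintegral_mono_ae ?_
    filter_upwards [hp_ne] with x hx
    have hA_slice : Measurable (A x) :=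
      (measurable_const.mul (hK.of_uncurry_left.mul (measurable_const.div hp))).enorm
    rw [← lintegral_const_mul' _ _ (by finiteness), ← lintegral_add_left hA_slice]
    exact lintegral_mono_ae (hp_ne.mono fun y hy => hpt x y hx hy)
  exact (ENNReal.mul_le_mul_iff_right (by norm_num) (by finiteness)).mp hsum

theorem ae_eq_zero_of_lintegral_le_lintegral_mul {f w : X → ENNReal} (hf : AEMeasurable f ν)
    (hf_fin : ∫⁻ x, f x ∂ν ≠ ⊤) (hw : ∀ᵐ x ∂ν, w x < 1)
    (hle : ∫⁻ x, f x ∂ν ≤ ∫⁻ x, f x * w x ∂ν) : f =ᵐ[ν] 0 := by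
  have hmul_le : (fun x => f x * w x) ≤ᵐ[ν] f := hw.mono fun x hx => mul_le_of_le_one_right' hx.le
  have heq := ae_eq_of_ae_le_of_lintegral_le hmul_le
    (ne_top_of_le_ne_top hf_fin (lintegral_mono_ae hmul_le)) hf hle
  filter_upwards [heq, hw, ae_lt_top' hf hf_fin] with x hx hwx hfx
  by_contra hne
  exact hwx.ne ((ENNReal.mul_right_inj hne hfx.ne).mp (hx.trans (mul_one _).symm))

end SchurTest

section StieltjesKernel

theorem hasDerivAt_arctan_sqrt_div {b t : ℝ} (hb : 0 < b) (ht : 0 < t) :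
    HasDerivAt (fun t => 2 / √b * Real.arctan (√t / √b)) (√t * (b + t))⁻¹ t := by
  have := Real.sqrt_pos.mpr hb
  have := Real.sqrt_pos.mpr ht
  refine (((((Real.hasDerivAt_sqrt ht.ne').div_const (√b)).arctan).const_mul
    (2 / √b))).congr_deriv ?_
  rw [div_pow, Real.sq_sqrt ht.le, Real.sq_sqrt hb.le]
  field_simp
  rw [Real.sq_sqrt hb.le]

theorem lintegral_inv_sqrt_mul_add {b : ℝ} (hb : 0 < b) :
    ∫⁻ t in Ioi (0 : ℝ), ENNReal.ofReal (√t * (b + t))⁻¹ = ENNReal.ofReal (Real.pi / √b) := by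
  have hcont : Continuous fun t => 2 / √b * Real.arctan (√t / √b) := by fun_prop
  have hderiv (t : ℝ) (ht : t ∈ Ioi (0 : ℝ)) := hasDerivAt_arctan_sqrt_div hb ht
  have hnonneg (t : ℝ) (ht : t ∈ Ioi (0 : ℝ)) : 0 ≤ (√t * (b + t))⁻¹ := by
    have ht : 0 < t := ht
    positivity
  have hlim : Tendsto (fun t => 2 / √b * Real.arctan (√t / √b)) atTop (𝓝 (Real.pi / √b)) := by
    have h := ((Real.tendsto_arctan_atTop.mono_right nhdsWithin_le_nhds).comp
      (Real.tendsto_sqrt_atTop.atTop_div_const (Real.sqrt_pos.mpr hb))).const_mul (2 / √b)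
    convert! h using 2
    ring
  rw [← ofReal_integral_eq_lintegral_ofReal
    (integrableOn_Ioi_deriv_of_nonneg hcont.continuousWithinAt hderiv hnonneg hlim)
    ((ae_restrict_mem measurableSet_Ioi).mono hnonneg),
    integral_Ioi_of_hasDerivAt_of_nonneg hcont.continuousWithinAt hderiv hnonneg hlim]
  simp

theorem lintegral_enorm_stieltjesKernel_mul_sqrt {x : ℝ} (hx : 0 < x) :
    ∫⁻ t in Ioi (0 : ℝ), ‖(1 + x + t)⁻¹ * (√x / √t)‖ₑ =
      ENNReal.ofReal (Real.pi * √(x / (1 + x))) := by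
  rw [setLIntegral_congr_fun measurableSet_Ioi
    (g := fun t => ENNReal.ofReal (√x) * ENNReal.ofReal (√t * (1 + x + t))⁻¹),
    lintegral_const_mul' _ _ (by finiteness), lintegral_inv_sqrt_mul_add (by positivity),
    ← ENNReal.ofReal_mul (by positivity), Real.sqrt_div hx.le]
  · congr 1
    ring
  · intro t ht
    have ht : 0 < t := ht
    change ‖(1 + x + t)⁻¹ * (√x / √t)‖ₑ = _ * _
    rw [Real.enorm_of_nonneg (by positivity), ← ENNReal.ofReal_mul (by positivity)]
    congr 1
    field_simp

theorem lintegral_lintegral_stieltjesKernel_le {ψ : ℝ → ℝ}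
    (hψ : AEMeasurable ψ (volume.restrict (Ioi 0))) :
    ∫⁻ x in Ioi (0 : ℝ), ∫⁻ t in Ioi (0 : ℝ), ‖(1 + x + t)⁻¹ * ψ x * ψ t‖ₑ ≤
      ENNReal.ofReal Real.pi *
        ∫⁻ x in Ioi (0 : ℝ), ‖ψ x‖ₑ ^ 2 * ENNReal.ofReal √(x / (1 + x)) := by
  refine (lintegral_lintegral_enorm_mul_mul_le (K := fun x t => (1 + x + t)⁻¹) (p := Real.sqrt)
    (by fun_prop) (fun x t => by rw [add_right_comm]) hψ (by fun_prop)
    ((ae_restrict_mem measurableSet_Ioi).mono fun x hx => (Real.sqrt_pos.mpr hx).ne')).trans_eq ?_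
  rw [← lintegral_const_mul' _ _ (by finiteness)]
  refine setLIntegral_congr_fun measurableSet_Ioi fun x hx => ?_
  simp only [enorm_mul (ψ x ^ 2)]
  rw [lintegral_const_mul' _ _ (by finiteness), lintegral_enorm_stieltjesKernel_mul_sqrt hx,
    ENNReal.ofReal_mul Real.pi_pos.le, enorm_pow]
  ring

/- The Schur test with weight `√` bounds the Stieltjes operator by `π`; since
`π √(x / (1 + x)) < π` pointwise, equality is attained at `0` only. -/
theorem ae_eq_zero_of_eq_stieltjesTransform {l : ℝ} (hl : |l * Real.pi| ≤ 1) {ψ : ℝ → ℝ}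
    (hψ : MemLp ψ 2 (volume.restrict (Ioi 0)))
    (h : ∀ x : ℝ, 0 < x → ψ x = l * ∫ t in Ioi (0 : ℝ), ψ t / (1 + t + x)) :
    ψ =ᵐ[volume.restrict (Ioi 0)] 0 := by
  have hψ_meas : AEMeasurable ψ (volume.restrict (Ioi 0)) := hψ.aestronglyMeasurable.aemeasurable
  have hsq_le (x : ℝ) (hx : x ∈ Ioi 0) :
      ‖ψ x‖ₑ ^ 2 ≤ ‖l‖ₑ * ∫⁻ t in Ioi (0 : ℝ), ‖(1 + x + t)⁻¹ * ψ x * ψ t‖ₑ := by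
    have hint : ‖∫ t in Ioi (0 : ℝ), ψ t / (1 + t + x)‖ₑ ≤
        ∫⁻ t in Ioi (0 : ℝ), ‖(1 + x + t)⁻¹ * ψ t‖ₑ := by
      simpa only [div_eq_inv_mul, add_right_comm] using
        enorm_integral_le_lintegral_enorm (μ := volume.restrict (Ioi 0)) fun t => ψ t / (1 + t + x)
    calc ‖ψ x‖ₑ ^ 2 = ‖ψ x‖ₑ * (‖l‖ₑ * ‖∫ t in Ioi (0 : ℝ), ψ t / (1 + t + x)‖ₑ) := by
          rw [sq, ← enorm_mul l, ← h x hx]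
      _ ≤ ‖ψ x‖ₑ * (‖l‖ₑ * ∫⁻ t in Ioi (0 : ℝ), ‖(1 + x + t)⁻¹ * ψ t‖ₑ) := by gcongr
      _ = _ := by
          rw [mul_left_comm, ← lintegral_const_mul' _ _ (by finiteness)]
          simp only [enorm_mul, mul_left_comm, mul_assoc]
  have hl_le : ‖l‖ₑ * ENNReal.ofReal Real.pi ≤ 1 := by
    rwa [← Real.enorm_of_nonneg Real.pi_pos.le, ← enorm_mul, ← ofReal_norm, Real.norm_eq_abs,
      ENNReal.ofReal_le_one]
  have hle : ∫⁻ x in Ioi 0, ‖ψ x‖ₑ ^ 2 ≤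
      ∫⁻ x in Ioi 0, ‖ψ x‖ₑ ^ 2 * ENNReal.ofReal √(x / (1 + x)) := by
    refine (setLIntegral_mono_ae' measurableSet_Ioi (ae_of_all _ hsq_le)).trans ?_
    rw [lintegral_const_mul' _ _ (by finiteness)]
    refine (mul_le_mul_right (lintegral_lintegral_stieltjesKernel_le hψ_meas) _).trans ?_
    rw [← mul_assoc]
    exact mul_le_of_le_one_left' hl_le
  have hfin : ∫⁻ x in Ioi 0, ‖ψ x‖ₑ ^ 2 ≠ ⊤ := by
    simpa [enorm_pow] using hψ.integrable_sq.hasFiniteIntegral.ne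
  have hsqrt_lt {x : ℝ} (hx : 0 < x) : ENNReal.ofReal √(x / (1 + x)) < 1 := by
    rw [ENNReal.ofReal_lt_one, Real.sqrt_lt' one_pos, one_pow, div_lt_one (by positivity)]
    linarith
  refine (ae_eq_zero_of_lintegral_le_lintegral_mul (hψ_meas.enorm.pow_const 2) hfin
    ((ae_restrict_mem measurableSet_Ioi).mono fun x hx => hsqrt_lt hx) hle).mono fun x hx => ?_
  simpa using hx

end StieltjesKernel

section CouplingConstant

variable {l : ℝ}

theorem abs_mul_pi_le_one (hl : |l| ≤ 1 / Real.pi) : |l * Real.pi| ≤ 1 := by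
  rwa [abs_mul, abs_of_pos Real.pi_pos, ← le_div_iff₀ Real.pi_pos]

theorem alphaOf_mem_Icc (l : ℝ) : alphaOf l ∈ Icc (-(1 / 2) : ℝ) (1 / 2) := by
  rw [alphaOf, mem_Icc, le_div_iff₀ Real.pi_pos, div_le_iff₀ Real.pi_pos]
  constructor <;>
    linarith [Real.arcsin_le_pi_div_two (l * Real.pi), Real.neg_pi_div_two_le_arcsin (l * Real.pi)]

theorem alphaOf_mem_Ioo (l : ℝ) : alphaOf l ∈ Ioo (-1 : ℝ) 1 :=
  Icc_subset_Ioo (by norm_num) (by norm_num) (alphaOf_mem_Icc l)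

theorem one_sub_alphaOf_ne_zero (l : ℝ) : 1 - alphaOf l ≠ 0 := by
  linarith [(alphaOf_mem_Ioo l).2]

theorem alphaOf_mem_Ioc (hl : -(1 / Real.pi) < l) : alphaOf l ∈ Ioc (-(1 / 2) : ℝ) (1 / 2) := by
  refine ⟨?_, (alphaOf_mem_Icc l).2⟩
  rwa [alphaOf, lt_div_iff₀ Real.pi_pos, show -(1 / 2) * Real.pi = -(Real.pi / 2) by ring,
    Real.neg_pi_div_two_lt_arcsin, ← div_lt_iff₀ Real.pi_pos, neg_div]

theorem sin_pi_mul_alphaOf_div_pi (hl : |l| ≤ 1 / Real.pi) :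
    Real.sin (Real.pi * alphaOf l) / Real.pi = l := by
  obtain ⟨hneg, hpos⟩ := abs_le.mp (abs_mul_pi_le_one hl)
  rw [alphaOf, mul_div_cancel₀ _ Real.pi_ne_zero, Real.sin_arcsin hneg hpos,
    mul_div_cancel_right₀ _ Real.pi_ne_zero]

theorem alphaOf_ne_zero (hl : |l| ≤ 1 / Real.pi) (hl_zero : l ≠ 0) : alphaOf l ≠ 0 := by
  intro h
  have hsin := sin_pi_mul_alphaOf_div_pi hl
  rw [h, mul_zero, Real.sin_zero, zero_div] at hsin
  exact hl_zero hsin.symm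

theorem cOf_eq_gaussPhiConst (hl : |l| ≤ 1 / Real.pi) : cOf l = gaussPhiConst (alphaOf l) := by
  have h := mul_gaussPhiConst (alphaOf_mem_Ioo l)
  rw [sin_pi_mul_alphaOf_div_pi hl] at h
  rw [cOf]
  split_ifs with hl_zero
  · simp [hl_zero, gaussPhiConst, alphaOf]
  · rw [div_eq_iff (mul_ne_zero (alphaOf_ne_zero hl hl_zero) (one_sub_alphaOf_ne_zero l)),
      mul_comm, h]

theorem cOf_ne_zero (hl : |l| ≤ 1 / Real.pi) : cOf l ≠ 0 :=
  cOf_eq_gaussPhiConst hl ▸ (gaussPhiConst_pos (alphaOf_mem_Ioo l)).ne'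

theorem mul_arcsinQuot (l : ℝ) : l * arcsinQuot l = alphaOf l := by
  rw [arcsinQuot, alphaOf]
  split_ifs with hl_zero
  · simp [hl_zero]
  · field_simp

theorem cOf_mul_arcsinQuot (hl : |l| ≤ 1 / Real.pi) :
    cOf l * arcsinQuot l = (1 - alphaOf l)⁻¹ := by
  rcases eq_or_ne l 0 with rfl | hl_zero
  · simp [cOf, arcsinQuot, alphaOf]
  · have := alphaOf_ne_zero hl hl_zero
    have := one_sub_alphaOf_ne_zero l
    refine mul_left_cancel₀ hl_zero ?_
    rw [mul_left_comm, mul_arcsinQuot, cOf, if_neg hl_zero]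
    field_simp

end CouplingConstant

section PhiEquation

variable {l c x : ℝ} {φ ψ : ℝ → ℝ}

theorem integrableOn_div_one_add_of_memLp (hψ : MemLp ψ 2 (volume.restrict (Ioi 0))) :
    IntegrableOn (fun t => ψ t / (1 + t)) (Ioi 0) :=
  (hψ.integrable_mul (memLp_one_add_rpow_neg one_half_lt_one)).congr <| ae_of_all _ fun t => by
    rw [Pi.mul_apply, Real.rpow_neg_one, ← div_eq_mul_inv]

theorem integrableOn_div_one_add_add_of_memLp (hψ : MemLp ψ 2 (volume.restrict (Ioi 0)))
    (hx : 0 ≤ x) : IntegrableOn (fun t => ψ t / (1 + t + x)) (Ioi 0) := by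
  simpa only [sub_neg_eq_add] using integrableOn_div_one_add_sub
    (integrableOn_div_one_add_of_memLp hψ) (show -x < 1 by linarith)

theorem eq_zero_of_eq_stieltjesTransform (hl : |l * Real.pi| ≤ 1)
    (hψ : MemLp ψ 2 (volume.restrict (Ioi 0)))
    (h : ∀ x : ℝ, 0 ≤ x → ψ x = l * ∫ t in Ioi (0 : ℝ), ψ t / (1 + t + x)) (hx : 0 ≤ x) :
    ψ x = 0 := by
  have hae := ae_eq_zero_of_eq_stieltjesTransform hl hψ fun x hx => h x hx.le
  rw [h x hx, integral_eq_zero_of_ae, mul_zero]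
  filter_upwards [hae] with t ht
  simp [ht]

theorem IsPhiSolution.congr (hφ : IsPhiSolution l c φ) (h : EqOn φ ψ (Ici 0)) :
    IsPhiSolution l c ψ := by
  have hae : φ =ᵐ[volume.restrict (Ioi 0)] ψ :=
    (ae_restrict_mem measurableSet_Ioi).mono fun t ht => h (Ioi_subset_Ici_self ht)
  refine ⟨hφ.1.ae_eq hae, (h self_mem_Ici).symm.trans hφ.2.1, fun x hx => ?_⟩
  have hint : ∫ t in Ioi (0 : ℝ), φ t / (1 + t + x) = ∫ t in Ioi (0 : ℝ), ψ t / (1 + t + x) :=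
    integral_congr_ae (hae.mono fun t ht => congrArg (· / (1 + t + x)) ht)
  rw [← h hx, hφ.2.2 x hx, hint]

theorem isPhiSolution_gaussPhi (hl : |l| ≤ 1 / Real.pi) (hl_gt : -(1 / Real.pi) < l) :
    IsPhiSolution l (cOf l) (gaussPhi (alphaOf l)) := by
  have hmem := memLp_gaussPhi (alphaOf_mem_Ioc hl_gt)
  refine ⟨hmem, gaussPhi_zero (alphaOf_mem_Ioo l), fun x hx => ?_⟩
  have h := gaussPhi_eq_sub_integral (alphaOf_mem_Ioo l) (integrableOn_div_one_add_of_memLp hmem)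
    (show -1 < x by linarith)
  rwa [mul_gaussPhiConst (alphaOf_mem_Ioo l), sin_pi_mul_alphaOf_div_pi hl,
    ← cOf_eq_gaussPhiConst hl] at h

/- Any two solutions are proportional, as the homogeneous equation has only the zero solution in
`L²`. -/
theorem IsPhiSolution.eq_div_mul {c₀ : ℝ} {φ₀ : ℝ → ℝ} (hl : |l| ≤ 1 / Real.pi) (hc₀ : c₀ ≠ 0)
    (hφ₀ : IsPhiSolution l c₀ φ₀) (hφ : IsPhiSolution l c φ) (hx : 0 ≤ x) :
    φ x = c / c₀ * φ₀ x := by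
  refine sub_eq_zero.mp (eq_zero_of_eq_stieltjesTransform (l := -l)
    (ψ := fun x => φ x - c / c₀ * φ₀ x) ?_ (hφ.1.sub (hφ₀.1.const_mul (c / c₀)))
    (fun x hx => ?_) hx)
  · rw [neg_mul, abs_neg]
    exact abs_mul_pi_le_one hl
  · simp only [sub_div, mul_div_assoc]
    rw [integral_sub (integrableOn_div_one_add_add_of_memLp hφ.1 hx)
      ((integrableOn_div_one_add_add_of_memLp hφ₀.1 hx).const_mul _), integral_const_mul,
      hφ.2.2 x hx, hφ₀.2.2 x hx]
    field_simp
    ring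

theorem isPhiSolution_iff (hl : |l| ≤ 1 / Real.pi) (hl_gt : -(1 / Real.pi) < l) :
    IsPhiSolution l c φ ↔
      c = cOf l ∧ φ 0 = 1 ∧ ∀ x : ℝ, 0 < x → φ x = gaussPhi (alphaOf l) x := by
  have hΦ := isPhiSolution_gaussPhi hl hl_gt
  constructor
  · intro hφ
    have hprop (x : ℝ) (hx : 0 ≤ x) := hΦ.eq_div_mul hl (cOf_ne_zero hl) hφ hx
    have hc := hprop 0 le_rfl
    rw [hφ.2.1, hΦ.2.1, mul_one, eq_div_iff (cOf_ne_zero hl), one_mul] at hc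
    refine ⟨hc.symm, hφ.2.1, fun x hx => ?_⟩
    rw [hprop x hx.le, ← hc, div_self (cOf_ne_zero hl), one_mul]
  · rintro ⟨rfl, hφ_zero, hφ⟩
    refine hΦ.congr fun x hx => ?_
    rcases (mem_Ici.mp hx).eq_or_lt with rfl | hx
    · rw [hΦ.2.1, hφ_zero]
    · exact (hφ x hx).symm

end PhiEquation

section FredholmEquation

variable {l μ : ℝ} {J : ℝ → ℝ}

theorem memLp_comp_mul_left_Ioi_iff {E : Type*} [NormedAddCommGroup E] {f : ℝ → E} {a : ℝ}
    {p : ENNReal} (ha : 0 < a) :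
    MemLp (fun u => f (a * u)) p (volume.restrict (Ioi 0)) ↔
      MemLp f p (volume.restrict (Ioi 0)) := by
  have hemb : MeasurableEmbedding (a * ·) := (Homeomorph.mulLeft₀ a ha.ne').measurableEmbedding
  have hmap : (volume.restrict (Ioi (0 : ℝ))).map (a * ·) =
      ENNReal.ofReal a⁻¹ • volume.restrict (Ioi (0 : ℝ)) := by
    have hpre : (a * ·) ⁻¹' Ioi 0 = Ioi 0 := by simp [ha]
    rw [← abs_of_pos (inv_pos.mpr ha), ← Measure.restrict_smul, ← Real.map_volume_mul_left ha.ne',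
      hemb.restrict_map, hpre]
  have h := hemb.memLp_map_measure_iff (g := f) (p := p) (μ := volume.restrict (Ioi (0 : ℝ)))
  rw [hmap] at h
  refine h.symm.trans ⟨fun hf => ?_, fun hf => hf.smul_measure (by finiteness)⟩
  refine hf.of_measure_le_smul (c := ENNReal.ofReal a) (by finiteness) ?_
  rw [smul_smul, ← ENNReal.ofReal_mul ha.le, mul_inv_cancel₀ ha.ne', ENNReal.ofReal_one, one_smul]

/-- The function `φ(u) = J(μ² u) / (μ² u (1 + u))` by which `J` enters the symmetrised equation,
with the value `1` assigned at the origin, where the quotient is `0 / 0`. -/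
noncomputable def rescaled (μ : ℝ) (J : ℝ → ℝ) (u : ℝ) : ℝ :=
  if u = 0 then 1 else J (μ ^ 2 * u) / (μ ^ 2 * u * (1 + u))

theorem rescaled_zero : rescaled μ J 0 = 1 := if_pos rfl

theorem rescaled_eq_iff {u v : ℝ} (hμ : 0 < μ) (hu : 0 < u) :
    rescaled μ J u = v ↔ J (μ ^ 2 * u) = μ ^ 2 * u * ((1 + u) * v) := by
  rw [rescaled, if_neg hu.ne', div_eq_iff (by positivity)]
  ring_nf

theorem memLp_rescaled_iff {p : ENNReal} (hμ : 0 < μ) :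
    MemLp (rescaled μ J) p (volume.restrict (Ioi 0)) ↔
      MemLp (fun x => J x / (x * (μ ^ 2 + x))) p (volume.restrict (Ioi 0)) := by
  have hμ_sq : 0 < μ ^ 2 := by positivity
  have hae : rescaled μ J =ᵐ[volume.restrict (Ioi 0)]
      μ ^ 2 • fun u => J (μ ^ 2 * u) / (μ ^ 2 * u * (μ ^ 2 + μ ^ 2 * u)) := by
    filter_upwards [ae_restrict_mem measurableSet_Ioi] with u hu
    have hu : 0 < u := hu
    rw [rescaled_eq_iff hμ hu, Pi.smul_apply, smul_eq_mul]
    field_simp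
  rw [memLp_congr_ae hae,
    ← memLp_comp_mul_left_Ioi_iff (f := fun x => J x / (x * (μ ^ 2 + x))) hμ_sq]
  refine ⟨fun h => ?_, fun h => h.const_smul _⟩
  have h_smul := h.const_smul (μ ^ 2)⁻¹
  rwa [inv_smul_smul₀ hμ_sq.ne'] at h_smul

/- With `t = μ² v` this is the partial fraction decomposition
`u v / ((1 + v) (1 + v + u)) = (1 + u) / (1 + v + u) - 1 / (1 + v)`. -/
theorem mul_integral_fredholmKernel_eq (hμ : 0 < μ)
    (hφ : MemLp (rescaled μ J) 2 (volume.restrict (Ioi 0))) {u : ℝ} (hu : 0 ≤ u) :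
    μ ^ 2 * u * ∫ t in Ioi (0 : ℝ), J t / ((t + μ ^ 2) ^ 2 * (t + μ ^ 2 + μ ^ 2 * u)) =
      (1 + u) * (∫ t in Ioi (0 : ℝ), rescaled μ J t / (1 + t + u)) -
        ∫ t in Ioi (0 : ℝ), rescaled μ J t / (1 + t) := by
  have hμ_sq : 0 < μ ^ 2 := by positivity
  have hscale := integral_comp_mul_left_Ioi
    (fun t => J t / ((t + μ ^ 2) ^ 2 * (t + μ ^ 2 + μ ^ 2 * u))) 0 hμ_sq
  rw [mul_zero, smul_eq_mul, eq_inv_mul_iff_mul_eq₀ hμ_sq.ne'] at hscale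
  rw [← hscale, ← integral_const_mul, ← integral_const_mul, ← integral_const_mul,
    ← integral_sub ((integrableOn_div_one_add_add_of_memLp hφ hu).const_mul _)
      (integrableOn_div_one_add_of_memLp hφ)]
  refine setIntegral_congr_fun measurableSet_Ioi fun v hv => ?_
  have hv : 0 < v := hv
  rw [show μ ^ 2 * v + μ ^ 2 + μ ^ 2 * u = μ ^ 2 * (1 + v + u) by ring,
    show μ ^ 2 * v + μ ^ 2 = μ ^ 2 * (1 + v) by ring, (rescaled_eq_iff (J := J) hμ hv).mp rfl]
  field_simp
  ring

theorem fredholm_eq_iff_rescaled_eq (hμ : 0 < μ)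
    (hφ : MemLp (rescaled μ J) 2 (volume.restrict (Ioi 0))) {u : ℝ} (hu : 0 < u) :
    (J (μ ^ 2 * u) = μ ^ 2 * u - l * (μ ^ 2 * u) ^ 2 *
        ∫ t in Ioi (0 : ℝ), J t / ((t + μ ^ 2) ^ 2 * (t + μ ^ 2 + μ ^ 2 * u))) ↔
      rescaled μ J u = (1 + l * ∫ t in Ioi (0 : ℝ), rescaled μ J t / (1 + t)) / (1 + u) -
        l * ∫ t in Ioi (0 : ℝ), rescaled μ J t / (1 + t + u) := by
  have hkernel := mul_integral_fredholmKernel_eq hμ hφ hu.le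
  rw [rescaled_eq_iff hμ hu]
  refine Eq.congr_right ?_
  field_simp
  linear_combination -l * hkernel

theorem isFredholmSolution_iff_rescaled (hμ : 0 < μ) :
    IsFredholmSolution l μ J ↔ J 0 = 0 ∧ ∃ c, IsPhiSolution l c (rescaled μ J) := by
  constructor
  · rintro ⟨hmem, hJ⟩
    have hφ := (memLp_rescaled_iff hμ).mpr hmem
    refine ⟨by simpa using hJ 0 le_rfl, 1 + l * ∫ t in Ioi (0 : ℝ), rescaled μ J t / (1 + t), hφ,
      rescaled_zero, fun u hu => ?_⟩
    rcases hu.eq_or_lt with rfl | hu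
    · simp [rescaled_zero]
    · exact (fredholm_eq_iff_rescaled_eq hμ hφ hu).mp (hJ _ (by positivity))
  · rintro ⟨hJ_zero, c, hφ, -, heq⟩
    have hc : c = 1 + l * ∫ t in Ioi (0 : ℝ), rescaled μ J t / (1 + t) := by
      have h := heq 0 le_rfl
      simp only [rescaled_zero, add_zero, div_one] at h
      linarith
    refine ⟨(memLp_rescaled_iff hμ).mp hφ, fun x hx => ?_⟩
    rcases hx.eq_or_lt with rfl | hx
    · simp [hJ_zero]
    · have hfredholm := (fredholm_eq_iff_rescaled_eq hμ hφ (div_pos hx (sq_pos_of_pos hμ))).mpr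
        (hc ▸ heq _ (by positivity))
      rwa [mul_div_cancel₀ x (by positivity)] at hfredholm

theorem isFredholmSolution_iff (hl : |l| ≤ 1 / Real.pi) (hl_gt : -(1 / Real.pi) < l)
    (hμ : 0 < μ) :
    IsFredholmSolution l μ J ↔ ∀ x : ℝ, 0 ≤ x →
      J x = x * gauss2F1 (alphaOf l) (1 - alphaOf l) 2 (-(x / μ ^ 2)) := by
  have hμ_sq : 0 < μ ^ 2 := by positivity
  have hrescaled (u : ℝ) (hu : 0 < u) : rescaled μ J u = gaussPhi (alphaOf l) u ↔
      J (μ ^ 2 * u) = μ ^ 2 * u * gauss2F1 (alphaOf l) (1 - alphaOf l) 2 (-u) := by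
    rw [rescaled_eq_iff hμ hu, gauss2F1_eq_one_add_mul_gaussPhi (alphaOf_mem_Ioo l) (by linarith)]
  simp only [isFredholmSolution_iff_rescaled hμ, isPhiSolution_iff hl hl_gt, exists_eq_left,
    rescaled_zero, true_and]
  constructor
  · rintro ⟨hJ_zero, h⟩ x hx
    rcases hx.eq_or_lt with rfl | hx
    · rw [hJ_zero, zero_mul]
    · have hx_div : 0 < x / μ ^ 2 := by positivity
      simpa only [mul_div_cancel₀ x hμ_sq.ne'] using (hrescaled _ hx_div).mp (h _ hx_div)
  · intro h
    refine ⟨by simpa using h 0 le_rfl, fun u hu => (hrescaled u hu).mpr ?_⟩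
    rw [h _ (by positivity), mul_div_cancel_left₀ _ hμ_sq.ne']

end FredholmEquation

section Primitive

theorem uIcc_zero_subset_Ioi {x : ℝ} (hx : -1 < x) : uIcc 0 x ⊆ Ioi (-1) := fun _ ht =>
  (lt_min (by norm_num) hx).trans_le ht.1

theorem intervalIntegrable_of_continuousOn_Ioi {u : ℝ → ℝ} (hu : ContinuousOn u (Ioi (-1))) {x : ℝ}
    (hx : -1 < x) : IntervalIntegrable u volume 0 x :=
  (hu.mono (uIcc_zero_subset_Ioi hx)).intervalIntegrable

theorem hasDerivAt_primitive {u : ℝ → ℝ} (hu : ContinuousOn u (Ioi (-1))) {x : ℝ} (hx : -1 < x) :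
    HasDerivAt (fun x => ∫ t in (0 : ℝ)..x, u t) (u x) x :=
  intervalIntegral.integral_hasDerivAt_right (intervalIntegrable_of_continuousOn_Ioi hu hx)
    (hu.stronglyMeasurableAtFilter isOpen_Ioi x hx) (hu.continuousAt (Ioi_mem_nhds hx))

theorem norm_integral_le_of_norm_le_mul_pow {E : Type*} [NormedAddCommGroup E] [NormedSpace ℝ E]
    {u : ℝ → E} {y K : ℝ} {N : ℕ} (h : ∀ t ∈ uIcc 0 y, t ≠ 0 → ‖u t‖ ≤ K * |t| ^ N) :
    ‖∫ t in (0 : ℝ)..y, u t‖ ≤ K / (N + 1) * |y| ^ (N + 1) := by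
  have hpow : ∫ t in uIoc 0 y, K * |t| ^ N = K / (N + 1) * |y| ^ (N + 1) := by
    have h := integral_pow_abs_sub_uIoc (a := 0) (b := y) (n := N)
    simp only [sub_zero] at h
    rw [integral_const_mul, h]
    ring
  have hint : IntegrableOn (fun t : ℝ => K * |t| ^ N) (uIoc 0 y) :=
    intervalIntegrable_iff.mp (Continuous.intervalIntegrable (by fun_prop) 0 y)
  rw [intervalIntegral.norm_intervalIntegral_eq, ← hpow]
  refine norm_integral_le_of_norm_le hint ?_
  filter_upwards [ae_restrict_mem measurableSet_uIoc,
    ae_restrict_of_ae (compl_mem_ae_iff.mpr (measure_singleton (0 : ℝ)))] with t ht ht_ne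
  exact h t (uIoc_subset_uIcc ht) ht_ne

theorem intervalIntegral_congr_of_ne_zero {E : Type*} [NormedAddCommGroup E] [NormedSpace ℝ E]
    {u v : ℝ → E} (h : ∀ t, t ≠ 0 → u t = v t) (x : ℝ) :
    ∫ t in (0 : ℝ)..x, u t = ∫ t in (0 : ℝ)..x, v t := by
  refine intervalIntegral.integral_congr_ae ?_
  filter_upwards [compl_mem_ae_iff.mpr (measure_singleton (0 : ℝ))] with t ht _
  exact h t ht

theorem continuousOn_div_one_add {u : ℝ → ℝ} (hu : ContinuousOn u (Ioi (-1))) :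
    ContinuousOn (fun t => u t / (1 + t)) (Ioi (-1)) :=
  hu.div (by fun_prop) fun t (ht : -1 < t) => by linarith

theorem exists_continuousOn_eq_div {k : ℝ → ℝ} (hk_zero : k 0 = 0)
    (hk : DifferentiableOn ℝ k (Ioi (-1))) :
    ∃ q : ℝ → ℝ, ContinuousOn q (Ioi (-1)) ∧ ∀ t, t ≠ 0 → k t / t = q t := by
  have h_mem : Ioi (-1 : ℝ) ∈ 𝓝 (0 : ℝ) := Ioi_mem_nhds (by norm_num)
  refine ⟨dslope k 0, (continuousOn_dslope h_mem).mpr ⟨hk.continuousOn, hk.differentiableAt h_mem⟩,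
    fun t ht => ?_⟩
  rw [dslope_of_ne _ ht, slope_def_field, hk_zero, sub_zero, sub_zero]

theorem hasSum_of_norm_sub_sum_range_le {E : Type*} [NormedAddCommGroup E] [CompleteSpace E]
    {a : ℕ → E} {B : ℕ → ℝ} {s : E} (h : ∀ N, ‖s - ∑ n ∈ Finset.range N, a n‖ ≤ B N)
    (hB : Summable B) : HasSum a s := by
  have ha : Summable a := by
    refine .of_norm_bounded (hB.add ((summable_nat_add_iff 1).mpr hB)) fun n => ?_
    calc ‖a n‖ = ‖(s - ∑ i ∈ Finset.range n, a i) - (s - ∑ i ∈ Finset.range (n + 1), a i)‖ := by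
          rw [Finset.sum_range_succ]
          congr 1
          abel
      _ ≤ B n + B (n + 1) := (norm_sub_le _ _).trans (add_le_add (h n) (h (n + 1)))
  rw [ha.hasSum_iff_tendsto_nat, tendsto_iff_norm_sub_tendsto_zero]
  refine squeeze_zero (fun _ => norm_nonneg _) (fun N => ?_) hB.tendsto_atTop_zero
  rw [norm_sub_rev]
  exact h N

end Primitive

section Hlog

theorem altWord_zero : altWord 0 = [] := rfl

theorem altWord_succ (n : ℕ) : altWord (n + 1) = 0 :: -1 :: altWord n := by
  simp [altWord, List.replicate_succ]

theorem Hlog_nil (x : ℝ) : Hlog x [] = 1 := by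
  rw [Hlog]

theorem Hlog_neg_one_cons (x : ℝ) (w : List ℝ) :
    Hlog x (-1 :: w) = ∫ t in (0 : ℝ)..x, Hlog t w / (1 + t) := by
  rw [Hlog, if_neg (fun h => by simpa using h (-1))]
  simp only [sub_neg_eq_add, add_comm]

theorem Hlog_zero_cons_neg_one_cons (x : ℝ) (w : List ℝ) :
    Hlog x (0 :: -1 :: w) = ∫ t in (0 : ℝ)..x, Hlog t (-1 :: w) / t := by
  rw [Hlog, if_neg (fun h => by simpa using h (-1))]
  simp only [sub_zero]

theorem Hlog_neg_one_cons_at_zero (w : List ℝ) : Hlog 0 (-1 :: w) = 0 := by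
  rw [Hlog_neg_one_cons, intervalIntegral.integral_same]

theorem differentiableOn_Hlog_neg_one_cons {w : List ℝ}
    (hw : ContinuousOn (fun x => Hlog x w) (Ioi (-1))) :
    DifferentiableOn ℝ (fun x => Hlog x (-1 :: w)) (Ioi (-1)) := by
  intro x hx
  simp only [Hlog_neg_one_cons]
  exact (hasDerivAt_primitive
    (continuousOn_div_one_add hw) hx).differentiableAt.differentiableWithinAt

theorem continuousOn_Hlog_zero_cons_neg_one_cons {w : List ℝ}
    (hw : DifferentiableOn ℝ (fun x => Hlog x (-1 :: w)) (Ioi (-1))) :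
    ContinuousOn (fun x => Hlog x (0 :: -1 :: w)) (Ioi (-1)) := by
  obtain ⟨q, hq_cont, hq⟩ := exists_continuousOn_eq_div (Hlog_neg_one_cons_at_zero w) hw
  intro x hx
  simp only [Hlog_zero_cons_neg_one_cons, intervalIntegral_congr_of_ne_zero hq]
  exact (hasDerivAt_primitive hq_cont hx).continuousAt.continuousWithinAt

theorem continuousOn_Hlog_altWord (n : ℕ) :
    ContinuousOn (fun x => Hlog x (altWord n)) (Ioi (-1)) := by
  induction n with
  | zero => simpa only [altWord_zero, Hlog_nil] using continuousOn_const
  | succ n ih =>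
    rw [altWord_succ]
    exact continuousOn_Hlog_zero_cons_neg_one_cons (differentiableOn_Hlog_neg_one_cons ih)

theorem intervalIntegrable_Hlog_div_one_add (n : ℕ) {x : ℝ} (hx : -1 < x) :
    IntervalIntegrable (fun t => Hlog t (altWord n) / (1 + t)) volume 0 x :=
  intervalIntegrable_of_continuousOn_Ioi
    (continuousOn_div_one_add (continuousOn_Hlog_altWord n)) hx

theorem intervalIntegrable_Hlog_neg_one_cons_div (n : ℕ) {x : ℝ} (hx : -1 < x) :
    IntervalIntegrable (fun t => Hlog t (-1 :: altWord n) / t) volume 0 x := by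
  obtain ⟨q, hq_cont, hq⟩ := exists_continuousOn_eq_div (Hlog_neg_one_cons_at_zero (altWord n))
    (differentiableOn_Hlog_neg_one_cons (continuousOn_Hlog_altWord n))
  refine (intervalIntegrable_of_continuousOn_Ioi hq_cont hx).congr_ae (ae_restrict_of_ae ?_)
  filter_upwards [compl_mem_ae_iff.mpr (measure_singleton (0 : ℝ))] with t ht
  exact (hq t ht).symm

end Hlog

section HlogSeries

variable {α x : ℝ}

theorem continuousOn_gaussF (hα : α ∈ Ioo (-1 : ℝ) 1) : ContinuousOn (gaussF α) (Ioi (-1)) :=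
  fun _ hx => (hasDerivAt_gaussF hα hx).continuousAt.continuousWithinAt

theorem continuousOn_gaussG (hα : α ∈ Ioo (-1 : ℝ) 1) : ContinuousOn (gaussG α) (Ioi (-1)) :=
  fun _ hx => (analyticAt_gaussG hα hx).continuousAt.continuousWithinAt

theorem integral_gaussF_div_one_add (hα : α ∈ Ioo (-1 : ℝ) 1) (hx : -1 < x) :
    ∫ t in (0 : ℝ)..x, gaussF α t / (1 + t) = x * gaussG α x := by
  rw [intervalIntegral.integral_eq_sub_of_hasDerivAt
    (fun t ht => hasDerivAt_mul_gaussG hα (uIcc_zero_subset_Ioi hx ht))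
    (intervalIntegrable_of_continuousOn_Ioi
      (continuousOn_div_one_add (continuousOn_gaussF hα)) hx), zero_mul, sub_zero]

theorem mul_integral_gaussG (hα : α ∈ Ioo (-1 : ℝ) 1) (hx : -1 < x) :
    α ^ 2 * ∫ t in (0 : ℝ)..x, gaussG α t = gaussF α x - 1 := by
  rw [← intervalIntegral.integral_const_mul, intervalIntegral.integral_eq_sub_of_hasDerivAt
    (fun t ht => hasDerivAt_gaussF hα (uIcc_zero_subset_Ioi hx ht))
    ((intervalIntegrable_of_continuousOn_Ioi (continuousOn_gaussG hα) hx).const_mul _),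
    gaussF_zero hα]

/-- The remainder after `N` terms of the hyperlogarithm series expected to sum to `gaussF`. -/
noncomputable def remainderF (α : ℝ) (N : ℕ) (x : ℝ) : ℝ :=
  gaussF α x - ∑ n ∈ Finset.range N, Hlog x (altWord n) * α ^ (2 * n)

/-- The remainder after `N` terms of the hyperlogarithm series expected to sum to `x * gaussG`. -/
noncomputable def remainderG (α : ℝ) (N : ℕ) (x : ℝ) : ℝ :=
  x * gaussG α x - ∑ n ∈ Finset.range N, Hlog x (-1 :: altWord n) * α ^ (2 * n)

theorem remainderG_eq_integral (hα : α ∈ Ioo (-1 : ℝ) 1) (N : ℕ) (hx : -1 < x) :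
    remainderG α N x = ∫ t in (0 : ℝ)..x, remainderF α N t / (1 + t) := by
  have hterm (n) (_ : n ∈ Finset.range N) :=
    (intervalIntegrable_Hlog_div_one_add n hx).mul_const (α ^ (2 * n))
  simp only [remainderF, sub_div, Finset.sum_div, mul_div_right_comm]
  rw [intervalIntegral.integral_sub
    (intervalIntegrable_of_continuousOn_Ioi
      (continuousOn_div_one_add (continuousOn_gaussF hα)) hx)
    (by simpa only [Finset.sum_fn] using IntervalIntegrable.sum _ hterm),
    intervalIntegral.integral_finsetSum hterm, integral_gaussF_div_one_add hα hx, remainderG]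
  simp only [intervalIntegral.integral_mul_const, Hlog_neg_one_cons]

theorem integral_remainderG_div (hα : α ∈ Ioo (-1 : ℝ) 1) (N : ℕ) (hx : -1 < x) :
    ∫ t in (0 : ℝ)..x, remainderG α N t / t =
      (∫ t in (0 : ℝ)..x, gaussG α t) -
        ∑ n ∈ Finset.range N, Hlog x (altWord (n + 1)) * α ^ (2 * n) := by
  have hterm (n) (_ : n ∈ Finset.range N) :=
    (intervalIntegrable_Hlog_neg_one_cons_div n hx).mul_const (α ^ (2 * n))
  have hsplit (t : ℝ) (ht : t ≠ 0) : remainderG α N t / t = gaussG α t -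
      ∑ n ∈ Finset.range N, Hlog t (-1 :: altWord n) / t * α ^ (2 * n) := by
    simp only [remainderG, sub_div, Finset.sum_div, mul_div_cancel_left₀ _ ht, mul_div_right_comm]
  rw [intervalIntegral_congr_of_ne_zero hsplit, intervalIntegral.integral_sub
    (intervalIntegrable_of_continuousOn_Ioi (continuousOn_gaussG hα) hx)
    (by simpa only [Finset.sum_fn] using IntervalIntegrable.sum _ hterm),
    intervalIntegral.integral_finsetSum hterm]
  simp only [intervalIntegral.integral_mul_const, ← Hlog_zero_cons_neg_one_cons, ← altWord_succ]

theorem remainderF_succ_eq_integral (hα : α ∈ Ioo (-1 : ℝ) 1) (N : ℕ) (hx : -1 < x) :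
    remainderF α (N + 1) x = α ^ 2 * ∫ t in (0 : ℝ)..x, remainderG α N t / t := by
  rw [integral_remainderG_div hα N hx, mul_sub, mul_integral_gaussG hα hx, remainderF,
    Finset.sum_range_succ', altWord_zero, Hlog_nil, Finset.mul_sum, sub_sub, add_comm]
  simp only [mul_zero, pow_zero, mul_one, mul_add, pow_add]
  congr 2
  exact Finset.sum_congr rfl fun n _ => by ring

theorem abs_remainderG_le (hα : α ∈ Ioo (-1 : ℝ) 1) {N : ℕ} (hx : -1 < x) {K M : ℝ} (hK : 0 ≤ K)
    (hM : ∀ t ∈ uIcc 0 x, (1 + t)⁻¹ ≤ M)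
    (hF : ∀ t ∈ uIcc 0 x, |remainderF α N t| ≤ K * |t| ^ N) :
    |remainderG α N x| ≤ M * K * |x| ^ (N + 1) := by
  have hM_nonneg : 0 ≤ M := zero_le_one.trans (by simpa using hM 0 left_mem_uIcc)
  have hbound : |remainderG α N x| ≤ M * K / (N + 1) * |x| ^ (N + 1) := by
    rw [remainderG_eq_integral hα N hx, ← Real.norm_eq_abs]
    refine norm_integral_le_of_norm_le_mul_pow fun t ht _ => ?_
    have ht_pos : 0 < 1 + t := by linarith [mem_Ioi.mp (uIcc_zero_subset_Ioi hx ht)]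
    calc ‖remainderF α N t / (1 + t)‖ = (1 + t)⁻¹ * |remainderF α N t| := by
          rw [Real.norm_eq_abs, abs_div, abs_of_pos ht_pos, div_eq_inv_mul]
      _ ≤ M * (K * |t| ^ N) :=
          mul_le_mul (hM t ht) (hF t ht) (abs_nonneg _) hM_nonneg
      _ = M * K * |t| ^ N := by ring
  refine hbound.trans ?_
  gcongr
  exact div_le_self (by positivity) (by linarith [N.cast_nonneg (α := ℝ)])

theorem abs_remainderF_succ_le (hα : α ∈ Ioo (-1 : ℝ) 1) {N : ℕ} (hx : -1 < x) {L : ℝ}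
    (hG : ∀ t ∈ uIcc 0 x, |remainderG α N t| ≤ L * |t| ^ (N + 1)) :
    |remainderF α (N + 1) x| ≤ α ^ 2 * (L / (N + 1) * |x| ^ (N + 1)) := by
  rw [remainderF_succ_eq_integral hα N hx, abs_mul, abs_of_nonneg (sq_nonneg α)]
  gcongr
  rw [← Real.norm_eq_abs]
  refine norm_integral_le_of_norm_le_mul_pow fun t ht ht_ne => ?_
  rw [Real.norm_eq_abs, abs_div, div_le_iff₀ (abs_pos.mpr ht_ne), mul_assoc, ← pow_succ]
  exact hG t ht

theorem abs_remainderF_le (hα : α ∈ Ioo (-1 : ℝ) 1) (hx : -1 < x) {C M : ℝ}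
    (hM : ∀ t ∈ uIcc 0 x, (1 + t)⁻¹ ≤ M) (hC : ∀ t ∈ uIcc 0 x, |gaussF α t| ≤ C) (N : ℕ) :
    ∀ y ∈ uIcc 0 x, |remainderF α N y| ≤ C * (α ^ 2 * M) ^ N / N.factorial * |y| ^ N := by
  have hC_nonneg : 0 ≤ C := (abs_nonneg _).trans (hC 0 left_mem_uIcc)
  have hM_nonneg : 0 ≤ M := zero_le_one.trans (by simpa using hM 0 left_mem_uIcc)
  induction N with
  | zero => simpa [remainderF] using hC
  | succ N ih =>
    have hG (y : ℝ) (hy : y ∈ uIcc 0 x) : |remainderG α N y| ≤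
        M * (C * (α ^ 2 * M) ^ N / N.factorial) * |y| ^ (N + 1) := by
      have hsub : uIcc 0 y ⊆ uIcc 0 x := uIcc_subset_uIcc left_mem_uIcc hy
      exact abs_remainderG_le hα (uIcc_zero_subset_Ioi hx hy) (by positivity)
        (fun t ht => hM t (hsub ht)) (fun t ht => ih t (hsub ht))
    intro y hy
    refine (abs_remainderF_succ_le hα (uIcc_zero_subset_Ioi hx hy) fun t ht =>
      hG t (uIcc_subset_uIcc left_mem_uIcc hy ht)).trans_eq ?_
    rw [Nat.factorial_succ, Nat.cast_mul, Nat.cast_succ, pow_succ (α ^ 2 * M)]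
    field_simp

theorem exists_abs_remainder_le (hα : α ∈ Ioo (-1 : ℝ) 1) (hx : -1 < x) :
    ∃ A r : ℝ, ∀ N : ℕ, |remainderF α N x| ≤ A * (r ^ N / N.factorial) ∧
      |remainderG α N x| ≤ A * (r ^ N / N.factorial) := by
  have hsub : uIcc 0 x ⊆ Ioi (-1) := uIcc_zero_subset_Ioi hx
  obtain ⟨C, hC⟩ := isCompact_uIcc.exists_bound_of_continuousOn ((continuousOn_gaussF hα).mono hsub)
  obtain ⟨M, hM⟩ := isCompact_uIcc.exists_bound_of_continuousOn
    ((continuousOn_div_one_add continuousOn_const (u := fun _ => 1)).mono hsub)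
  replace hM (t : ℝ) (ht : t ∈ uIcc 0 x) : (1 + t)⁻¹ ≤ M :=
    one_div (1 + t) ▸ (le_abs_self _).trans (hM t ht)
  have hC_nonneg : 0 ≤ C := (norm_nonneg _).trans (hC 0 left_mem_uIcc)
  have hM_nonneg : 0 ≤ M := zero_le_one.trans (by simpa using hM 0 left_mem_uIcc)
  have hF := abs_remainderF_le hα hx hM hC
  refine ⟨C * max 1 (M * |x|), α ^ 2 * M * |x|, fun N => ⟨?_, ?_⟩⟩
  · calc |remainderF α N x| ≤ C * (α ^ 2 * M) ^ N / N.factorial * |x| ^ N := hF N x right_mem_uIcc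
      _ = C * 1 * ((α ^ 2 * M * |x|) ^ N / N.factorial) := by ring
      _ ≤ _ := by gcongr; exact le_max_left _ _
  · calc |remainderG α N x| ≤ M * (C * (α ^ 2 * M) ^ N / N.factorial) * |x| ^ (N + 1) :=
          abs_remainderG_le hα hx (by positivity) hM (hF N)
      _ = C * (M * |x|) * ((α ^ 2 * M * |x|) ^ N / N.factorial) := by ring
      _ ≤ _ := by gcongr; exact le_max_right _ _

theorem hasSum_Hlog_altWord (hα : α ∈ Ioo (-1 : ℝ) 1) (hx : -1 < x) :
    HasSum (fun n => Hlog x (altWord n) * α ^ (2 * n)) (gaussF α x) := by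
  obtain ⟨A, r, h⟩ := exists_abs_remainder_le hα hx
  exact hasSum_of_norm_sub_sum_range_le (fun N => (h N).1)
    ((Real.summable_pow_div_factorial r).mul_left A)

theorem hasSum_Hlog_neg_one_cons_altWord (hα : α ∈ Ioo (-1 : ℝ) 1) (hx : -1 < x) :
    HasSum (fun n => Hlog x (-1 :: altWord n) * α ^ (2 * n)) (x * gaussG α x) := by
  obtain ⟨A, r, h⟩ := exists_abs_remainder_le hα hx
  exact hasSum_of_norm_sub_sum_range_le (fun N => (h N).2)
    ((Real.summable_pow_div_factorial r).mul_left A)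

end HlogSeries

section NonnegativeCoefficients

variable {p q : PowerSeries ℝ} {F : ℝ → ℝ} {r : ℝ}

theorem coeff_mul_nonneg (hp : ∀ k, 0 ≤ p.coeff k) (hq : ∀ k, 0 ≤ q.coeff k) (k : ℕ) :
    0 ≤ (p * q).coeff k := by
  rw [PowerSeries.coeff_mul]
  exact Finset.sum_nonneg fun ij _ => mul_nonneg (hp ij.1) (hq ij.2)

theorem coeff_pow_nonneg (hp : ∀ k, 0 ≤ p.coeff k) (m k : ℕ) : 0 ≤ (p ^ m).coeff k := by
  induction m generalizing k with
  | zero =>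
    rw [pow_zero, PowerSeries.coeff_one]
    split_ifs <;> norm_num
  | succ m ih => exact pow_succ p m ▸ coeff_mul_nonneg ih hp k

theorem HasPowerSum.nonneg (h : HasPowerSum p F r) (hp : ∀ k, 0 ≤ p.coeff k) {x : ℝ}
    (hx_nonneg : 0 ≤ x) (hx : x < r) : 0 ≤ F x :=
  (h x (by rwa [Real.norm_of_nonneg hx_nonneg])).nonneg fun k =>
    mul_nonneg (hp k) (pow_nonneg hx_nonneg k)

/- Nonnegative coefficients make the double family `H m * (p m).coeff k * x ^ k` summable as soon
as the `H m * F m |x|` are, and `X ^ m ∣ p m` makes the inner sums finite after exchanging them. -/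
theorem hasSum_sum_range_coeff_mul {p : ℕ → PowerSeries ℝ} {F : ℕ → ℝ → ℝ} {H : ℕ → ℝ} {x S : ℝ}
    (h : ∀ m, HasPowerSum (p m) (F m) r) (hp : ∀ m k, 0 ≤ (p m).coeff k)
    (hX : ∀ m, PowerSeries.X ^ m ∣ p m) (hx : |x| < r)
    (habs : Summable fun m => H m * F m |x|) (hS : HasSum (fun m => H m * F m x) S) :
    HasSum (fun k => (∑ m ∈ Finset.range (k + 1), (p m).coeff k * H m) * x ^ k) S := by
  let f : ℕ × ℕ → ℝ := fun mk => H mk.1 * ((p mk.1).coeff mk.2 * x ^ mk.2)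
  have hnorm (mk : ℕ × ℕ) : ‖f mk‖ = |H mk.1| * ((p mk.1).coeff mk.2 * |x| ^ mk.2) := by
    simp only [f, norm_mul, norm_pow, Real.norm_eq_abs, abs_of_nonneg (hp _ _)]
  have hfiber (m : ℕ) : HasSum (fun k => ‖f (m, k)‖) (|H m| * F m |x|) := by
    simpa only [hnorm] using (h m |x| (by simpa using hx)).mul_left |H m|
  have hf : Summable f := by
    refine .of_norm ((summable_prod_of_nonneg fun mk => norm_nonneg (f mk)).mpr
      ⟨fun m => (hfiber m).summable, habs.abs.congr fun m => ?_⟩)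
    rw [(hfiber m).tsum_eq, abs_mul, abs_of_nonneg ((h m).nonneg (hp m) (abs_nonneg x) hx)]
  have hsum : HasSum f S :=
    hS.unique (hf.hasSum.prod_fiberwise fun m => (h m x hx).mul_left (H m)) ▸ hf.hasSum
  refine ((Equiv.prodComm ℕ ℕ).hasSum_iff.mpr hsum).prod_fiberwise fun k => ?_
  have hvanish (m : ℕ) (hm : m ∉ Finset.range (k + 1)) : f (m, k) = 0 := by
    have hkm : k < m := by simpa using hm
    simp [f, PowerSeries.X_pow_dvd_iff.mp (hX m) k hkm]
  have hinner : (∑ m ∈ Finset.range (k + 1), (p m).coeff k * H m) * x ^ k =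
      ∑ m ∈ Finset.range (k + 1), f (m, k) := by
    rw [Finset.sum_mul]
    exact Finset.sum_congr rfl fun m _ => by ring
  exact hinner ▸ hasSum_sum_of_ne_finset_zero hvanish

/-- The composition of the geometric series with a power series `p` without constant term, that is,
the power series of `1 / (1 - p)`. -/
noncomputable def geometricSeries (p : PowerSeries ℝ) : PowerSeries ℝ :=
  PowerSeries.mk fun k => ∑ m ∈ Finset.range (k + 1), (p ^ m).coeff k

theorem coeff_geometricSeries_nonneg (hp : ∀ k, 0 ≤ p.coeff k) (k : ℕ) :
    0 ≤ (geometricSeries p).coeff k := by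
  rw [geometricSeries, PowerSeries.coeff_mk]
  exact Finset.sum_nonneg fun m _ => coeff_pow_nonneg hp m k

theorem HasPowerSum.inv_one_sub (h : HasPowerSum p F r) (hp : ∀ k, 0 ≤ p.coeff k)
    (hX : PowerSeries.X ∣ p) (hF : ∀ x, |x| < r → |F x| < 1) :
    HasPowerSum (geometricSeries p) (fun x => (1 - F x)⁻¹) r := fun x hx => by
  have hgeom (y : ℝ) (hy : |y| < r) : HasSum (fun m => 1 * F y ^ m) (1 - F y)⁻¹ := by
    simpa only [one_mul] using hasSum_geometric_of_abs_lt_one (hF y hy)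
  have hsum := hasSum_sum_range_coeff_mul h.pow (coeff_pow_nonneg hp)
    (fun m => pow_dvd_pow_of_dvd hX m) hx (hgeom |x| (by rwa [abs_abs])).summable (hgeom x hx)
  simpa only [geometricSeries, PowerSeries.coeff_mk, mul_one] using hsum

end NonnegativeCoefficients

section ArcsinSeries

theorem arcsin_eq_mul_integral {x : ℝ} (hx : |x| < 1) :
    Real.arcsin x = x * ∫ s in Ioo (0 : ℝ) 1, (1 - x ^ 2 * s ^ 2) ^ (-(1 / 2) : ℝ) := by
  have habs (s : ℝ) (hs : s ∈ uIcc (0 : ℝ) 1) : |x * s| < 1 := by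
    rw [uIcc_of_le zero_le_one] at hs
    rw [abs_mul, abs_of_nonneg hs.1]
    exact (mul_le_of_le_one_right (abs_nonneg x) hs.2).trans_lt hx
  have hpos (s : ℝ) (hs : s ∈ uIcc (0 : ℝ) 1) : 0 < 1 - x ^ 2 * s ^ 2 := by
    rw [← mul_pow, sub_pos, sq_lt_one_iff_abs_lt_one]
    exact habs s hs
  have hderiv (s : ℝ) (hs : s ∈ uIcc (0 : ℝ) 1) : HasDerivAt (fun s => Real.arcsin (x * s))
      (x * (1 - x ^ 2 * s ^ 2) ^ (-(1 / 2) : ℝ)) s := by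
    have h := abs_lt.mp (habs s hs)
    refine ((Real.hasDerivAt_arcsin h.1.ne' h.2.ne).comp s
      ((hasDerivAt_id' s).const_mul x)).congr_deriv ?_
    rw [Real.rpow_neg (hpos s hs).le, ← Real.sqrt_eq_rpow, mul_pow]
    ring
  have hcont : ContinuousOn (fun s : ℝ => x * (1 - x ^ 2 * s ^ 2) ^ (-(1 / 2) : ℝ)) (uIcc 0 1) :=
    continuousOn_const.mul
      (ContinuousOn.rpow_const (by fun_prop) fun s hs => Or.inl (hpos s hs).ne')
  have hint := intervalIntegral.integral_eq_sub_of_hasDerivAt hderiv hcont.intervalIntegrable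
  rw [mul_one, mul_zero, Real.arcsin_zero, sub_zero, intervalIntegral.integral_const_mul,
    intervalIntegral.integral_of_le zero_le_one, integral_Ioc_eq_integral_Ioo] at hint
  exact hint.symm

/-- The Taylor series of `arcsin` at the origin. -/
noncomputable def arcsinSeries : PowerSeries ℝ :=
  PowerSeries.mk fun k => if Odd k then (negBinomialSeries (1 / 2)).coeff (k / 2) / k else 0

theorem coeff_arcsinSeries_nonneg (k : ℕ) : 0 ≤ arcsinSeries.coeff k := by
  rw [arcsinSeries, PowerSeries.coeff_mk]
  split_ifs
  · rw [negBinomialSeries, PowerSeries.coeff_mk]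
    have := (ascPochhammer_pos (k / 2) (1 / 2 : ℝ) (by norm_num)).le
    positivity
  · exact le_rfl

theorem X_dvd_arcsinSeries : PowerSeries.X ∣ arcsinSeries := by
  rw [PowerSeries.X_dvd_iff, ← PowerSeries.coeff_zero_eq_constantCoeff_apply, arcsinSeries,
    PowerSeries.coeff_mk, if_neg (by decide)]

theorem hasPowerSum_arcsin : HasPowerSum arcsinSeries Real.arcsin 1 := fun x hx => by
  have hsum := (hasPowerSum_one_sub_rpow_neg (1 / 2)).integral_comp_mul
    (ν := volume.restrict (Ioo (0 : ℝ) 1)) (w := fun _ => 1) (u := fun s => s ^ 2)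
    (integrable_const 1) (by fun_prop) one_pos (by
      filter_upwards [ae_restrict_mem measurableSet_Ioo] with s hs
      rw [Real.norm_of_nonneg (sq_nonneg s)]
      exact pow_le_one₀ hs.1.le hs.2.le) (x ^ 2)
    (by simpa using hx)
  have hmoment (n : ℕ) : ∫ s in Ioo (0 : ℝ) 1, (s ^ 2) ^ n = 1 / (2 * n + 1) := by
    simp [← pow_mul, ← integral_Ioc_eq_integral_Ioo, ← intervalIntegral.integral_of_le]
  have hodd : HasSum (fun n => arcsinSeries.coeff (2 * n + 1) * x ^ (2 * n + 1))
      (Real.arcsin x) := by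
    rw [arcsin_eq_mul_integral hx]
    simp only [one_mul, hmoment, PowerSeries.coeff_mk] at hsum
    refine (hsum.mul_left x).congr_fun fun n => ?_
    rw [arcsinSeries, PowerSeries.coeff_mk, if_pos (odd_two_mul_add_one n),
      show (2 * n + 1) / 2 = n by omega]
    push_cast
    ring
  have heven : HasSum (fun n => arcsinSeries.coeff (2 * n) * x ^ (2 * n)) 0 := by
    refine hasSum_zero.congr_fun fun n => ?_
    rw [arcsinSeries, PowerSeries.coeff_mk, if_neg (by simp), zero_mul]
  simpa only [zero_add] using
    HasSum.even_add_odd (f := fun k => arcsinSeries.coeff k * x ^ k) heven hodd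

/-- The Taylor series at the origin of `α = arcsin (π l) / π` as a function of `l`. -/
noncomputable def alphaSeries : PowerSeries ℝ :=
  PowerSeries.C Real.pi⁻¹ * PowerSeries.rescale Real.pi arcsinSeries

theorem coeff_alphaSeries (k : ℕ) :
    alphaSeries.coeff k = Real.pi⁻¹ * (Real.pi ^ k * arcsinSeries.coeff k) := by
  rw [alphaSeries, PowerSeries.coeff_C_mul, PowerSeries.coeff_rescale]

theorem coeff_alphaSeries_nonneg (k : ℕ) : 0 ≤ alphaSeries.coeff k := by
  have := coeff_arcsinSeries_nonneg k
  rw [coeff_alphaSeries]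
  positivity

theorem X_dvd_alphaSeries : PowerSeries.X ∣ alphaSeries := by
  rw [PowerSeries.X_dvd_iff, ← PowerSeries.coeff_zero_eq_constantCoeff_apply, coeff_alphaSeries,
    PowerSeries.coeff_zero_eq_constantCoeff_apply, PowerSeries.X_dvd_iff.mp X_dvd_arcsinSeries,
    mul_zero, mul_zero]

theorem hasPowerSum_alphaOf : HasPowerSum alphaSeries alphaOf (1 / Real.pi) := fun l hl => by
  have hl : ‖l * Real.pi‖ < 1 := by
    rwa [norm_mul, Real.norm_of_nonneg Real.pi_pos.le, ← lt_div_iff₀ Real.pi_pos]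
  rw [alphaOf, div_eq_inv_mul]
  refine ((hasPowerSum_arcsin _ hl).mul_left _).congr_fun fun k => ?_
  rw [coeff_alphaSeries, mul_pow]
  ring

theorem hasPowerSum_alphaOf_pow_div (n : ℕ) :
    HasPowerSum (alphaSeries ^ n * geometricSeries alphaSeries)
      (fun l => alphaOf l ^ n / (1 - alphaOf l)) (1 / Real.pi) :=
  (hasPowerSum_alphaOf.pow n).mul (hasPowerSum_alphaOf.inv_one_sub coeff_alphaSeries_nonneg
    X_dvd_alphaSeries fun l _ => abs_lt.mpr (alphaOf_mem_Ioo l))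

theorem alphaTaylor_eq_coeff (k n : ℕ) :
    alphaTaylor k n = (alphaSeries ^ n * geometricSeries alphaSeries).coeff k :=
  ((hasPowerSum_alphaOf_pow_div n).coeff_eq (by positivity) k).symm

end ArcsinSeries

section CouplingExpansion

theorem hasSum_letterTerm {α : ℝ} (hα : α ∈ Ioo (-1 : ℝ) 1) {u : ℝ} (hu : 0 < u) :
    HasSum (fun n => letterTerm u n * (α ^ n / (1 - α))) (gauss2F1 α (1 - α) 2 (-u)) := by
  have hα_ne : 1 - α ≠ 0 := by linarith [hα.2]
  have hu_gt : -1 < u := by linarith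
  have heven : HasSum (fun m => letterTerm u (2 * m) * (α ^ (2 * m) / (1 - α)))
      (gaussF α u * (1 - α)⁻¹) := by
    refine ((hasSum_Hlog_altWord hα hu_gt).mul_right (1 - α)⁻¹).congr_fun fun m => ?_
    rw [letterTerm, if_pos (even_two_mul m), Nat.mul_div_cancel_left m two_pos]
    ring
  have hodd : HasSum (fun m => letterTerm u (2 * m + 1) * (α ^ (2 * m + 1) / (1 - α)))
      (u * gaussG α u * (-((1 + u) / u) * α * (1 - α)⁻¹)) := by
    refine ((hasSum_Hlog_neg_one_cons_altWord hα hu_gt).mul_right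
      (-((1 + u) / u) * α * (1 - α)⁻¹)).congr_fun fun m => ?_
    rw [letterTerm, if_neg (by simp), show (2 * m + 1) / 2 = m by omega]
    ring
  convert! HasSum.even_add_odd (f := fun n => letterTerm u n * (α ^ n / (1 - α))) heven hodd using 1
  rw [gauss2F1_eq_one_add_mul_gaussPhi hα hu_gt]
  refine mul_left_cancel₀ hα_ne ?_
  rw [mul_left_comm, one_sub_mul_gaussPhi hα hu_gt]
  field_simp
  ring

theorem hasSum_JCoeff {l μ x : ℝ} (hl : |l| < 1 / Real.pi) (hμ : 0 < μ) (hx : 0 < x) :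
    HasSum (fun k => JCoeff μ x k * l ^ k)
      (x * gauss2F1 (alphaOf l) (1 - alphaOf l) 2 (-(x / μ ^ 2))) := by
  have hletter (l : ℝ) := hasSum_letterTerm (alphaOf_mem_Ioo l) (u := x / μ ^ 2) (by positivity)
  have hsum := hasSum_sum_range_coeff_mul hasPowerSum_alphaOf_pow_div
    (fun n => coeff_mul_nonneg (coeff_pow_nonneg coeff_alphaSeries_nonneg n)
      (coeff_geometricSeries_nonneg coeff_alphaSeries_nonneg))
    (fun n => (pow_dvd_pow_of_dvd X_dvd_alphaSeries n).mul_right _) hl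
    (hletter |l|).summable (hletter l)
  simpa only [JCoeff, alphaTaylor_eq_coeff, mul_assoc] using hsum.mul_left x

end CouplingExpansion

theorem phiHlog_eq_gaussPhi {l x : ℝ} (hl : |l| ≤ 1 / Real.pi) (hx : 0 < x) :
    phiHlog l x = gaussPhi (alphaOf l) x := by
  have hα := alphaOf_mem_Ioo l
  have hα_ne := one_sub_alphaOf_ne_zero l
  have hx_gt : -1 < x := by linarith
  have hcoeff : l * cOf l * arcsinQuot l ^ 2 = alphaOf l * (1 - alphaOf l)⁻¹ := by
    rw [← cOf_mul_arcsinQuot hl, ← mul_arcsinQuot]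
    ring
  have hφ := one_sub_mul_gaussPhi hα hx_gt
  rw [phiHlog, fHlog, gHlog, (hasSum_Hlog_altWord hα hx_gt).tsum_eq,
    (hasSum_Hlog_neg_one_cons_altWord hα hx_gt).tsum_eq, hcoeff, cOf_mul_arcsinQuot hl,
    ← mul_right_inj' hα_ne, hφ]
  field_simp

theorem mainTheorem5 (l : ℝ) (hl : |l| ≤ 1 / Real.pi) :
    -- the two hyperlogarithm series
    (∀ x : ℝ, -1 < x →
      Summable (fun n : ℕ => Hlog x (altWord n) * alphaOf l ^ (2 * n)) ∧
      Summable (fun n : ℕ => Hlog x (-1 :: altWord n) * alphaOf l ^ (2 * n)) ∧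
      fHlog l x = gauss2F1 (alphaOf l) (-alphaOf l) 1 (-x) ∧
      gHlog l x = x * gauss2F1 (1 + alphaOf l) (1 - alphaOf l) 2 (-x)) ∧
    (-(1 / Real.pi) < l →
      -- the combination of `f` and `g` is the unique solution of the equation for `φ`
      (∀ (c : ℝ) (φ : ℝ → ℝ), IsPhiSolution l c φ ↔
        c = cOf l ∧ φ 0 = 1 ∧ ∀ x : ℝ, 0 < x → φ x = phiHlog l x) ∧
      (∀ x : ℝ, 0 < x →
        phiHlog l x = gauss2F1 (1 + alphaOf l) (2 - alphaOf l) 2 (-x)) ∧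
      -- the solution of the original Fredholm equation
      (∀ μ : ℝ, 0 < μ →
        (∀ J : ℝ → ℝ, IsFredholmSolution l μ J ↔
          ∀ x : ℝ, 0 ≤ x →
            J x = x * gauss2F1 (alphaOf l) (1 - alphaOf l) 2 (-(x / μ ^ 2))) ∧
        (∀ x : ℝ, 0 < x →
          x * gauss2F1 (alphaOf l) (1 - alphaOf l) 2 (-(x / μ ^ 2)) =
            x * (1 + x / μ ^ 2) * phiHlog l (x / μ ^ 2)))) ∧
    -- its power series in the coupling constant, to all orders
    (|l| < 1 / Real.pi → ∀ μ : ℝ, 0 < μ → ∀ x : ℝ, 0 < x →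
      HasSum (fun k : ℕ => JCoeff μ x k * l ^ k)
        (x * gauss2F1 (alphaOf l) (1 - alphaOf l) 2 (-(x / μ ^ 2)))) := by
  have hα := alphaOf_mem_Ioo l
  refine ⟨fun x hx => ?_, fun hl_gt => ⟨fun c φ => ?_, fun x hx => phiHlog_eq_gaussPhi hl hx,
    fun μ hμ => ⟨fun J => isFredholmSolution_iff hl hl_gt hμ, fun x hx => ?_⟩⟩,
    fun hl_lt μ hμ x hx => hasSum_JCoeff hl_lt hμ hx⟩
  · have hf := hasSum_Hlog_altWord hα hx
    have hg := hasSum_Hlog_neg_one_cons_altWord hα hx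
    exact ⟨hf.summable, hg.summable, hf.tsum_eq, hg.tsum_eq⟩
  · simp +contextual only [isPhiSolution_iff hl hl_gt, phiHlog_eq_gaussPhi hl]
  · have hu : 0 < x / μ ^ 2 := by positivity
    rw [gauss2F1_eq_one_add_mul_gaussPhi hα (by linarith), phiHlog_eq_gaussPhi hl hu, mul_assoc]
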